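/- Let $\mathbb T^2=\mathbb R^2/\mathbb Z^2$ and let $g(x,y)=(2x+y,x+y)$ on $\mathbb T^2$, with unit eigenvectors $v^u$ and $v^s$ of eigenvalues $\lambda_u=\frac{3+\sqrt5}2$ and $\lambda_s=\frac{3-\sqrt5}2$. Let $0<r_0\le\frac12$, let $U$ be the ball of radius $r_0$ around the origin $p_0\in\mathbb T^2$ with coordinates $u_1v^u+u_2v^s$, and let $\delta\colon\mathbb R\to[0,1]$ be a non-increasing $C^\infty$ bump function with $\delta(x)=1$ for $x\le r_0/2$ and $\delta(x)=0$ for $x\ge r_0$. Let $\phi$ be the flow on $\mathbb T^2$ of the vector field $v(u_1,u_2)=\bigl(0,\,u_2\,\delta(\sqrt{u_1^2+u_2^2})\bigr)$ on $U$, $v=0$ outside $U$. Fix any $\tau$ with $e^{\tau}\lambda_s>1$ (so that the origin becomes a source), and let $f_{DA}=\phi_\tau\circ g$ be the derived-from-Anosov map. It satisfies $f_{DA}(-p)=-f_{DA}(p)$. Let $\pi\colon\mathbb T^2\to\mathbb S^2=\mathbb T^2/(p\sim-p)$ be the antipodal quotient, whose quotient space is a two-sphere, with the quotient metric $d(\pi(p),\pi(q))=\min\{d(p,q),d(p,-q)\}$,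 and let $f_{PDA}\colon\mathbb S^2\to\mathbb S^2$ be the homeomorphism with $f_{PDA}\circ\pi=\pi\circ f_{DA}$ (the pseudo-DA homeomorphism). Let $\tilde\Lambda=\Omega(f_{PDA})\setminus\{\pi(p_0)\}$ be the piece of the non-wandering set $\Omega(f_{PDA})$ other than the repelling fixed point $\pi(p_0)$. Then: 1. $f_{PDA}$ is cw-expansive on $\tilde\Lambda$: there is $\varepsilon>0$ such that for every closed connected set $C\subset\tilde\Lambda$ with more than one point there is $n\in\mathbb Z$ with $\operatorname{diam}(f_{PDA}^n(C))>\varepsilon$. 2. $\tilde\Lambda$ is isolated for $f_{PDA}$: it is closed, $f_{PDA}(\tilde\Lambda)=\tilde\Lambda$, and it has a neighborhood $V$ such that every $x\in\mathbb S^2$ with $f_{PDA}^n(x)\in V$ for all $n\in\mathbb Z$ belongs to $\tilde\Lambda$. -/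

import Mathlib

open Set Filter Topology
open scoped NNReal ContDiff

/-! ### Topological dynamics: wandering, isolation, continuum-wise expansivity -/

section Dynamics

/-- The non-wandering set of a homeomorphism. -/
def nonwanderingSet {X : Type*} [TopologicalSpace X] (f : X ≃ₜ X) : Set X :=
  {x | ∀ U ∈ 𝓝 x, ∃ n : ℕ, 1 ≤ n ∧ (((f ^ n : X ≃ₜ X) '' U) ∩ U).Nonempty}

/-- `L` is an isolated set of `f`: it is closed and invariant, and it has an isolating
neighbourhood `V`. -/
def IsIsolatedSet {X : Type*} [TopologicalSpace X] (f : X ≃ₜ X) (L : Set X) : Prop :=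
  IsClosed L ∧ f '' L = L ∧
    ∃ V ∈ 𝓝ˢ L, ∀ x : X, (∀ n : ℤ, (f ^ n : X ≃ₜ X) x ∈ V) → x ∈ L

/-- `f` is cw-expansive on the closed invariant set `L`: there is `ε > 0` such that every
continuum `C ⊆ L` with more than one point has an iterate of diameter larger than `ε`. -/
def CwExpansiveOn {X : Type*} [MetricSpace X] (f : X ≃ₜ X) (L : Set X) : Prop :=
  ∃ ε : ℝ, 0 < ε ∧ ∀ C : Set X, C ⊆ L → IsClosed C → IsConnected C → C.Nontrivial →
    ∃ n : ℤ, ε < Metric.diam ((f ^ n : X ≃ₜ X) '' C)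

end Dynamics

noncomputable section

namespace PseudoDA

/-! ### The torus, the antipodal quotient and its metric -/

/-- The two-torus `ℝ² / ℤ²`. -/
abbrev T2 : Type := UnitAddCircle × UnitAddCircle

/-- The covering projection `ℝ² → 𝕋²`. -/
def proj (x : ℝ × ℝ) : T2 := ((x.1 : UnitAddCircle), (x.2 : UnitAddCircle))

/-- The antipodal equivalence relation `p ∼ -p` on the torus. -/
def antipodal : Setoid T2 where
  r p q := p = q ∨ p = -q
  iseqv :=
    { refl := fun _ => Or.inl rfl
      symm := by
        rintro p q (h | h)
        · exact Or.inl h.symm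
        · exact Or.inr (by rw [h, neg_neg])
      trans := by
        rintro p q r (h | h) (h' | h')
        · exact Or.inl (h.trans h')
        · exact Or.inr (h.trans h')
        · exact Or.inr (by rw [h, h'])
        · exact Or.inl (by rw [h, h', neg_neg]) }

/-- The two-sphere `𝕊²`, as the antipodal quotient of the torus. -/
def S2 : Type := Quotient antipodal

/-- The quotient map `π : 𝕋² → 𝕊²`. -/
def quo (p : T2) : S2 := Quotient.mk antipodal p

lemma quo_surjective : Function.Surjective quo := Quotient.mk_surjective

lemma quo_eq_iff {p q : T2} : quo p = quo q ↔ p = q ∨ p = -q :=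
  ⟨fun h => Quotient.exact h, fun h => Quotient.sound h⟩

lemma quo_neg (p : T2) : quo (-p) = quo p := quo_eq_iff.2 (Or.inr rfl)

/-- The quotient distance between `[p]` and `[q]`: the distance between the sets `{p, -p}` and
`{q, -q}`. -/
def quoDist : S2 → S2 → ℝ :=
  Quotient.lift₂ (fun p q : T2 => min (dist p q) (dist p (-q))) (by
    have key : ∀ p q : T2, dist (-p) q = dist p (-q) := fun p q => by
      rw [← dist_neg_neg, neg_neg]
    rintro p q p' q' (rfl | rfl) (rfl | rfl)
    · rfl
    · simp only [neg_neg]; exact min_comm _ _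
    · simp only [key, neg_neg]; exact min_comm _ _
    · simp only [key, neg_neg])

lemma quoDist_mk (p q : T2) : quoDist (quo p) (quo q) = min (dist p q) (dist p (-q)) := rfl

/-- The quotient metric, before its topology is identified with the quotient topology. -/
@[reducible] def quoMetricAux : MetricSpace S2 where
  dist := quoDist
  dist_self x := by
    obtain ⟨p, rfl⟩ := quo_surjective x
    rw [quoDist_mk, dist_self]; exact min_eq_left dist_nonneg
  dist_comm x y := by
    obtain ⟨p, rfl⟩ := quo_surjective x
    obtain ⟨q, rfl⟩ := quo_surjective y
    rw [quoDist_mk, quoDist_mk, dist_comm p q, dist_comm p (-q), ← dist_neg_neg (-q) p, neg_neg]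
  dist_triangle x y z := by
    obtain ⟨p, rfl⟩ := quo_surjective x
    obtain ⟨q, rfl⟩ := quo_surjective y
    obtain ⟨r, rfl⟩ := quo_surjective z
    simp only [quoDist_mk]
    have h1 := dist_triangle p q r
    have h2 := dist_triangle p (-q) r
    have h3 := dist_triangle p q (-r)
    have h4 := dist_triangle p (-q) (-r)
    have h5 : dist (-q) (-r) = dist q r := dist_neg_neg q r
    have h6 : dist (-q) r = dist q (-r) := by rw [← dist_neg_neg, neg_neg]
    rcases min_cases (dist p q) (dist p (-q)) with ⟨e, _⟩ | ⟨e, _⟩ <;>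
    rcases min_cases (dist q r) (dist q (-r)) with ⟨e', _⟩ | ⟨e', _⟩ <;>
    rw [e, e'] <;>
    first
      | exact (min_le_left _ _).trans (by linarith)
      | exact (min_le_right _ _).trans (by linarith)
  eq_of_dist_eq_zero := by
    intro x y h
    obtain ⟨p, rfl⟩ := quo_surjective x
    obtain ⟨q, rfl⟩ := quo_surjective y
    change min (dist p q) (dist p (-q)) = 0 at h
    rw [quo_eq_iff]
    rcases min_cases (dist p q) (dist p (-q)) with ⟨e, _⟩ | ⟨e, _⟩
    · exact Or.inl (dist_eq_zero.1 (e ▸ h))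
    · exact Or.inr (dist_eq_zero.1 (e ▸ h))

lemma quoMetricAux_topology : quoMetricAux.toUniformSpace.toTopologicalSpace =
    TopologicalSpace.coinduced quo inferInstance := by
  let _ := quoMetricAux
  have hc : Continuous quo := by
    refine LipschitzWith.continuous (K := 1) (LipschitzWith.of_dist_le_mul fun p q => ?_)
    rw [NNReal.coe_one, one_mul]
    exact min_le_left _ _
  have ho : IsOpenMap quo := by
    intro U hU
    rw [Metric.isOpen_iff]
    rintro _ ⟨p, hp, rfl⟩
    obtain ⟨ε, hε, hb⟩ := Metric.isOpen_iff.1 hU p hp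
    refine ⟨ε, hε, fun y hy => ?_⟩
    obtain ⟨q, rfl⟩ := quo_surjective y
    have hy' : min (dist q p) (dist q (-p)) < ε := hy
    rcases min_lt_iff.1 hy' with h | h
    · exact ⟨q, hb h, rfl⟩
    · refine ⟨-q, hb ?_, quo_neg q⟩
      rw [Metric.mem_ball, ← dist_neg_neg, neg_neg]; exact h
  exact (ho.isQuotientMap hc quo_surjective).eq_coinduced

/-- The quotient topology. -/
instance instTopologicalSpaceS2 : TopologicalSpace S2 :=
  inferInstanceAs (TopologicalSpace (Quotient antipodal))

lemma isQuotientMap_quo : IsQuotientMap quo := isQuotientMap_quot_mk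

lemma quo_topology_eq :
    instTopologicalSpaceS2 = quoMetricAux.toUniformSpace.toTopologicalSpace :=
  isQuotientMap_quo.eq_coinduced.trans quoMetricAux_topology.symm

/-- `𝕊²` with the quotient metric, whose topology is the quotient topology. -/
instance : MetricSpace S2 := quoMetricAux.replaceTopology quo_topology_eq

lemma dist_quo (p q : T2) : dist (quo p) (quo q) = min (dist p q) (dist p (-q)) := rfl

/-! ### The Anosov automorphism and its eigendirections -/

/-- The linear Anosov diffeomorphism `g (x, y) = (2 x + y, x + y)` of the torus. -/
def anosov : T2 ≃ₜ T2 where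
  toFun p := (p.1 + p.1 + p.2, p.1 + p.2)
  invFun p := (p.1 - p.2, p.2 + p.2 - p.1)
  left_inv p := by ext <;> simp only <;> abel
  right_inv p := by ext <;> simp only <;> abel
  continuous_toFun := by fun_prop
  continuous_invFun := by fun_prop

/-- The unit unstable eigenvector of `(x, y) ↦ (2 x + y, x + y)`, of eigenvalue
`(3 + √5) / 2`. -/
def vu : ℝ × ℝ :=
  (√(1 + Real.goldenRatio ^ 2))⁻¹ • ((Real.goldenRatio, 1) : ℝ × ℝ)

/-- The unit stable eigenvector of `(x, y) ↦ (2 x + y, x + y)`, of eigenvalue `(3 - √5) / 2`. -/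
def vs : ℝ × ℝ :=
  (√(1 + Real.goldenRatio ^ 2))⁻¹ • ((1, -Real.goldenRatio) : ℝ × ℝ)

/-- The coordinate `u₁` of `x = u₁ vu + u₂ vs`. -/
def coordU (x : ℝ × ℝ) : ℝ := x.1 * vu.1 + x.2 * vu.2

/-- The coordinate `u₂` of `x = u₁ vu + u₂ vs`. -/
def coordS (x : ℝ × ℝ) : ℝ := x.1 * vs.1 + x.2 * vs.2

lemma vu_eigen : (2 * vu.1 + vu.2, vu.1 + vu.2) = ((3 + √5) / 2) • vu := by
  have h5 : √5 * √5 = (5 : ℝ) := Real.mul_self_sqrt (by norm_num)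
  ext
  · simp only [vu, Real.goldenRatio, Prod.smul_fst, Prod.smul_snd, smul_eq_mul]
    linear_combination (-(√(1 + ((1 + √5) / 2) ^ 2))⁻¹ / 4) * h5
  · simp only [vu, Real.goldenRatio, Prod.smul_fst, Prod.smul_snd, smul_eq_mul]
    ring

lemma vs_eigen : (2 * vs.1 + vs.2, vs.1 + vs.2) = ((3 - √5) / 2) • vs := by
  have h5 : √5 * √5 = (5 : ℝ) := Real.mul_self_sqrt (by norm_num)
  ext
  · simp only [vs, Real.goldenRatio, Prod.smul_fst, Prod.smul_snd, smul_eq_mul]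
    ring
  · simp only [vs, Real.goldenRatio, Prod.smul_fst, Prod.smul_snd, smul_eq_mul]
    linear_combination (-(√(1 + ((1 + √5) / 2) ^ 2))⁻¹ / 4) * h5

lemma inv_sqrt_sq : (√(1 + Real.goldenRatio ^ 2))⁻¹ ^ 2 * (1 + Real.goldenRatio ^ 2) = 1 := by
  have h : (0 : ℝ) < 1 + Real.goldenRatio ^ 2 := by positivity
  rw [inv_pow, Real.sq_sqrt h.le, inv_mul_cancel₀ h.ne']

lemma coordU_smul_add_coordS_smul (x : ℝ × ℝ) : coordU x • vu + coordS x • vs = x := by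
  have h := inv_sqrt_sq
  ext
  · simp only [coordU, coordS, vu, vs, Prod.smul_fst, Prod.smul_snd, Prod.fst_add, smul_eq_mul]
    linear_combination x.1 * h
  · simp only [coordU, coordS, vu, vs, Prod.smul_fst, Prod.smul_snd, Prod.snd_add, smul_eq_mul]
    linear_combination x.2 * h

lemma coord_sq (x : ℝ × ℝ) : coordU x ^ 2 + coordS x ^ 2 = x.1 ^ 2 + x.2 ^ 2 := by
  have h := inv_sqrt_sq
  simp only [coordU, coordS, vu, vs, Prod.smul_fst, Prod.smul_snd, smul_eq_mul]
  linear_combination (x.1 ^ 2 + x.2 ^ 2) * h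

/-! ### The vector field -/

/-- The data of the derived-from-Anosov construction: the radius `r₀` of the ball, which embeds
in the torus, a non-increasing smooth bump function `δ`, and a time `τ` so large that the origin
becomes a source. -/
structure Data where
  r₀ : ℝ
  r₀_pos : 0 < r₀
  r₀_le : r₀ ≤ 1 / 2
  δ : ℝ → ℝ
  δ_smooth : ContDiff ℝ ∞ δ
  δ_mem : ∀ x, δ x ∈ Icc (0 : ℝ) 1
  δ_antitone : Antitone δ
  δ_eq_one : ∀ x, x ≤ r₀ / 2 → δ x = 1
  δ_eq_zero : ∀ x, r₀ ≤ x → δ x = 0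
  τ : ℝ
  τ_large : 1 < Real.exp τ * ((3 - √5) / 2)

variable (P : Data)

/-- The vector field `(u₁, u₂) ↦ (0, u₂ δ (√(u₁² + u₂²)))` of the plane, supported in the ball of
radius `r₀` around the origin. -/
def bumpField (x : ℝ × ℝ) : ℝ × ℝ :=
  (coordS x * P.δ (√(coordU x ^ 2 + coordS x ^ 2))) • vs

/-- The representative of `x` modulo `ℤ²` with coordinates in `[-1/2, 1/2)`. -/
def centred (x : ℝ × ℝ) : ℝ × ℝ := (x.1 - round x.1, x.2 - round x.2)

/-- The vector field `v` of the torus that is `bumpField` in the ball around the origin and zero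
elsewhere, as a `ℤ²`-periodic vector field of the plane. -/
def field (x : ℝ × ℝ) : ℝ × ℝ := bumpField P (centred x)

lemma bumpField_eq_zero {x : ℝ × ℝ} (h : P.r₀ ≤ √(coordU x ^ 2 + coordS x ^ 2)) :
    bumpField P x = 0 := by
  simp [bumpField, P.δ_eq_zero _ h]

lemma bumpField_neg (x : ℝ × ℝ) : bumpField P (-x) = -bumpField P x := by
  have h1 : coordU (-x) = -coordU x := by simp [coordU]; ring
  have h2 : coordS (-x) = -coordS x := by simp [coordS]; ring
  simp [bumpField, h1, h2]

lemma field_add_int (x : ℝ × ℝ) (m n : ℤ) : field P (x + ((m : ℝ), (n : ℝ))) = field P x := by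
  simp [field, centred]

lemma field_eq_of_ne {x : ℝ × ℝ} (m n : ℤ) (h : bumpField P (x - ((m : ℝ), (n : ℝ))) ≠ 0) :
    field P x = bumpField P (x - ((m : ℝ), (n : ℝ))) := by
  have h1 := lt_of_not_ge fun h' => h (bumpField_eq_zero P h')
  rw [coord_sq, Real.sqrt_lt' P.r₀_pos] at h1
  have h2 : P.r₀ ^ 2 ≤ (1 / 2) ^ 2 := pow_le_pow_left₀ P.r₀_pos.le P.r₀_le 2
  simp only [Prod.fst_sub, Prod.snd_sub] at h1
  have h3 : |x.1 - m| < 1 / 2 := abs_lt_of_sq_lt_sq (by nlinarith [sq_nonneg (x.2 - n)]) (by norm_num)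
  have h4 : |x.2 - n| < 1 / 2 := abs_lt_of_sq_lt_sq (by nlinarith [sq_nonneg (x.1 - m)]) (by norm_num)
  have key : ∀ (y : ℝ) (k : ℤ), |y - k| < 1 / 2 → round y = k := by
    intro y k hk
    rw [abs_lt] at hk
    rw [round_eq, Int.floor_eq_iff]
    constructor <;> linarith
  have e1 := key _ _ h3
  have e2 := key _ _ h4
  simp only [field, centred, e1, e2]
  rfl

lemma field_neg (x : ℝ × ℝ) : field P (-x) = -field P x := by
  have key : ∀ y : ℝ × ℝ, field P y ≠ 0 → field P (-y) = -field P y := by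
    intro y hy
    have e : -y - (((-round y.1 : ℤ) : ℝ), ((-round y.2 : ℤ) : ℝ)) = -centred y := by
      ext <;> simp [centred] <;> ring
    have hne : bumpField P (-y - (((-round y.1 : ℤ) : ℝ), ((-round y.2 : ℤ) : ℝ))) ≠ 0 := by
      rw [e, bumpField_neg]; exact neg_ne_zero.2 hy
    rw [field_eq_of_ne P _ _ hne, e, bumpField_neg]; rfl
  by_cases hx : field P x = 0
  · by_cases hx' : field P (-x) = 0
    · rw [hx, hx', neg_zero]
    · have := key _ hx'
      rw [neg_neg, hx] at this
      exact absurd (neg_eq_zero.1 this.symm) hx'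
  · exact key x hx

lemma abs_inv_sqrt_le : |(√(1 + Real.goldenRatio ^ 2))⁻¹| ≤ 1 ∧
    |(√(1 + Real.goldenRatio ^ 2))⁻¹ * Real.goldenRatio| ≤ 1 := by
  have h := inv_sqrt_sq
  constructor
  · refine abs_le_of_sq_le_sq ?_ (by norm_num)
    nlinarith [sq_nonneg ((√(1 + Real.goldenRatio ^ 2))⁻¹ * Real.goldenRatio)]
  · refine abs_le_of_sq_le_sq ?_ (by norm_num)
    nlinarith [sq_nonneg ((√(1 + Real.goldenRatio ^ 2))⁻¹)]

lemma norm_vs_le : ‖vs‖ ≤ 1 := by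
  obtain ⟨h1, h2⟩ := abs_inv_sqrt_le
  rw [Prod.norm_def]
  refine max_le ?_ ?_
  · rw [vs, Prod.smul_fst, smul_eq_mul, mul_one]; exact h1
  · rw [vs, Prod.smul_snd, smul_eq_mul, mul_neg, norm_neg]; exact h2

lemma abs_coordS_le (x : ℝ × ℝ) : |coordS x| ≤ 2 * ‖x‖ := by
  obtain ⟨h1, h2⟩ := abs_inv_sqrt_le
  have e1 : |x.1| ≤ ‖x‖ := norm_fst_le x
  have e2 : |x.2| ≤ ‖x‖ := norm_snd_le x
  have e3 : |coordS x| ≤ |x.1| * 1 + |x.2| * 1 := by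
    refine (abs_add_le _ _).trans ?_
    rw [abs_mul, abs_mul]
    gcongr
    · rw [vs, Prod.smul_fst, smul_eq_mul, mul_one]; exact h1
    · rw [vs, Prod.smul_snd, smul_eq_mul, mul_neg, abs_neg]; exact h2
  linarith

lemma abs_coordU_le (x : ℝ × ℝ) : |coordU x| ≤ 2 * ‖x‖ := by
  obtain ⟨h1, h2⟩ := abs_inv_sqrt_le
  have e1 : |x.1| ≤ ‖x‖ := norm_fst_le x
  have e2 : |x.2| ≤ ‖x‖ := norm_snd_le x
  have e3 : |coordU x| ≤ |x.1| * 1 + |x.2| * 1 := by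
    refine (abs_add_le _ _).trans ?_
    rw [abs_mul, abs_mul]
    gcongr
    · rw [vu, Prod.smul_fst, smul_eq_mul]; exact h2
    · rw [vu, Prod.smul_snd, smul_eq_mul, mul_one]; exact h1
  linarith

lemma coordS_sub (x y : ℝ × ℝ) : coordS (x - y) = coordS x - coordS y := by
  simp [coordS]; ring

lemma coordU_sub (x y : ℝ × ℝ) : coordU (x - y) = coordU x - coordU y := by
  simp [coordU]; ring

lemma abs_radius_sub_le (x y : ℝ × ℝ) :
    |√(coordU x ^ 2 + coordS x ^ 2) - √(coordU y ^ 2 + coordS y ^ 2)| ≤ 4 * ‖x - y‖ := by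
  have e : ∀ z : ℝ × ℝ, √(coordU z ^ 2 + coordS z ^ 2) = ‖(⟨coordU z, coordS z⟩ : ℂ)‖ :=
    fun z => by rw [Complex.norm_eq_sqrt_sq_add_sq]
  rw [e, e]
  refine (abs_norm_sub_norm_le _ _).trans ((Complex.norm_le_abs_re_add_abs_im _).trans ?_)
  have h1 := abs_coordU_le (x - y)
  have h2 := abs_coordS_le (x - y)
  rw [coordU_sub] at h1
  rw [coordS_sub] at h2
  simp only [Complex.sub_re, Complex.sub_im]
  linarith

lemma abs_coordS_le_radius (x : ℝ × ℝ) : |coordS x| ≤ √(coordU x ^ 2 + coordS x ^ 2) :=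
  Real.abs_le_sqrt (by nlinarith [sq_nonneg (coordU x)])

lemma norm_bumpField_le (x : ℝ × ℝ) : ‖bumpField P x‖ ≤ 1 := by
  by_cases h : P.r₀ ≤ √(coordU x ^ 2 + coordS x ^ 2)
  · simp [bumpField_eq_zero P h]
  · have h1 := (abs_coordS_le_radius x).trans (not_le.1 h).le
    obtain ⟨d0, d1⟩ := P.δ_mem (√(coordU x ^ 2 + coordS x ^ 2))
    rw [bumpField, norm_smul, Real.norm_eq_abs, abs_mul, abs_of_nonneg d0]
    have h2 := P.r₀_le
    have h3 : |coordS x| * P.δ (√(coordU x ^ 2 + coordS x ^ 2)) ≤ 1 :=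
      mul_le_one₀ (by linarith) d0 d1
    exact mul_le_one₀ h3 (norm_nonneg _) norm_vs_le

lemma exists_lipschitz_bump : ∃ K : ℝ, 0 ≤ K ∧ ∀ s t : ℝ, |P.δ s - P.δ t| ≤ K * |s - t| := by
  have hd : Differentiable ℝ P.δ := P.δ_smooth.differentiable (by simp)
  have hc : Continuous (deriv P.δ) := P.δ_smooth.continuous_deriv (by simp)
  obtain ⟨K, hK⟩ := (isCompact_Icc (a := P.r₀ / 2) (b := P.r₀)).exists_bound_of_continuousOn
    hc.continuousOn
  have hb : ∀ x, ‖deriv P.δ x‖ ≤ max K 0 := by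
    intro x
    by_cases h1 : x < P.r₀ / 2
    · have : P.δ =ᶠ[𝓝 x] fun _ => (1 : ℝ) := by
        filter_upwards [Iio_mem_nhds h1] with y hy using P.δ_eq_one y (le_of_lt hy)
      rw [this.deriv_eq]; simp
    · by_cases h2 : P.r₀ < x
      · have : P.δ =ᶠ[𝓝 x] fun _ => (0 : ℝ) := by
          filter_upwards [Ioi_mem_nhds h2] with y hy using P.δ_eq_zero y (le_of_lt hy)
        rw [this.deriv_eq]; simp
      · exact (hK x ⟨not_lt.1 h1, not_lt.1 h2⟩).trans (le_max_left _ _)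
  refine ⟨max K 0, le_max_right _ _, fun s t => ?_⟩
  exact Convex.norm_image_sub_le_of_norm_deriv_le (s := univ) (fun x _ => hd x)
    (fun x _ => hb x) convex_univ (mem_univ t) (mem_univ s)

lemma exists_lipschitz_bumpField : ∃ K : ℝ, 0 ≤ K ∧ ∀ x y : ℝ × ℝ,
    ‖bumpField P x - bumpField P y‖ ≤ K * ‖x - y‖ := by
  obtain ⟨K, hK0, hK⟩ := exists_lipschitz_bump P
  have key : ∀ x y : ℝ × ℝ, √(coordU x ^ 2 + coordS x ^ 2) < P.r₀ →
      ‖bumpField P x - bumpField P y‖ ≤ (2 + 4 * K) * ‖x - y‖ := by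
    intro x y hx
    have hr := P.r₀_le
    rw [bumpField, bumpField, ← sub_smul, norm_smul, Real.norm_eq_abs]
    set a := P.δ (√(coordU x ^ 2 + coordS x ^ 2))
    set b := P.δ (√(coordU y ^ 2 + coordS y ^ 2)) with hb
    have h1 : |a - b| ≤ K * (4 * ‖x - y‖) :=
      (hK _ _).trans (mul_le_mul_of_nonneg_left (abs_radius_sub_le x y) hK0)
    have h2 : |coordS x| ≤ 1 := by linarith [abs_coordS_le_radius x]
    have h3 : |coordS x - coordS y| ≤ 2 * ‖x - y‖ := by
      rw [← coordS_sub]; exact abs_coordS_le _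
    obtain ⟨b0, b1⟩ := P.δ_mem (√(coordU y ^ 2 + coordS y ^ 2))
    have h4 : |b| ≤ 1 := by rw [abs_of_nonneg b0]; exact b1
    have h5 : |coordS x * a - coordS y * b| ≤ (2 + 4 * K) * ‖x - y‖ := by
      have e : coordS x * a - coordS y * b = coordS x * (a - b) + (coordS x - coordS y) * b := by
        ring
      rw [e]
      refine (abs_add_le _ _).trans ?_
      rw [abs_mul, abs_mul]
      have h6 : |coordS x| * |a - b| ≤ 1 * (K * (4 * ‖x - y‖)) := by gcongr
      have h7 : |coordS x - coordS y| * |b| ≤ (2 * ‖x - y‖) * 1 := by gcongr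
      linarith
    calc _ ≤ |coordS x * a - coordS y * b| * 1 := by gcongr; exact norm_vs_le
      _ ≤ _ := by rw [mul_one]; exact h5
  refine ⟨2 + 4 * K, by positivity, fun x y => ?_⟩
  by_cases hx : √(coordU x ^ 2 + coordS x ^ 2) < P.r₀
  · exact key x y hx
  · by_cases hy : √(coordU y ^ 2 + coordS y ^ 2) < P.r₀
    · rw [norm_sub_rev, norm_sub_rev x y]; exact key y x hy
    · rw [bumpField_eq_zero P (not_lt.1 hx), bumpField_eq_zero P (not_lt.1 hy), sub_zero, norm_zero]
      positivity

lemma exists_lipschitz_field : ∃ K : ℝ≥0, LipschitzWith K (field P) := by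
  obtain ⟨K, hK0, hK⟩ := exists_lipschitz_bumpField P
  refine ⟨Real.toNNReal (2 * K), LipschitzWith.of_dist_le_mul fun x y => ?_⟩
  rw [dist_eq_norm, dist_eq_norm, Real.coe_toNNReal _ (by positivity)]
  have key : ∀ x y : ℝ × ℝ, ‖field P x - bumpField P (y - ((round x.1 : ℝ), (round x.2 : ℝ)))‖ ≤
      K * ‖x - y‖ := by
    intro x y
    have h := hK (centred x) (y - ((round x.1 : ℝ), (round x.2 : ℝ)))
    have e : centred x - (y - ((round x.1 : ℝ), (round x.2 : ℝ))) = x - y := by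
      ext <;> simp [centred]
    rwa [e] at h
  have hk : K * ‖x - y‖ ≤ 2 * K * ‖x - y‖ := by nlinarith [norm_nonneg (x - y)]
  by_cases h1 : bumpField P (y - ((round x.1 : ℝ), (round x.2 : ℝ))) = 0
  · by_cases h2 : bumpField P (x - ((round y.1 : ℝ), (round y.2 : ℝ))) = 0
    · have k1 := key x y
      have k2 := key y x
      rw [h1, sub_zero] at k1
      rw [h2, sub_zero, norm_sub_rev] at k2
      exact (norm_sub_le _ _).trans (by linarith)
    · have k2 := key y x
      rw [← field_eq_of_ne P _ _ h2, norm_sub_rev, norm_sub_rev y x] at k2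
      exact k2.trans hk
  · have k1 := key x y
    rw [← field_eq_of_ne P _ _ h1] at k1
    exact k1.trans hk

/-! ### The flow -/

lemma exists_integralCurve_Icc (x : ℝ × ℝ) (T : ℝ) (hT : 0 < T) :
    ∃ γ : ℝ → ℝ × ℝ, γ 0 = x ∧ ∀ t ∈ Ioo (-T) T, HasDerivAt γ (field P (γ t)) t := by
  obtain ⟨K, hK⟩ := exists_lipschitz_field P
  have h0 : (0 : ℝ) ∈ Icc (-T) T := ⟨by linarith, hT.le⟩
  have hPL : IsPicardLindelof (fun _ => field P) (⟨0, h0⟩ : Icc (-T) T) x (Real.toNNReal T) 0 1 K := by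
    refine IsPicardLindelof.of_time_independent (fun y _ => ?_) hK.lipschitzOnWith ?_
    · exact norm_bumpField_le P _
    · simp [hT.le]
  obtain ⟨γ, h1, h2⟩ := hPL.exists_eq_forall_mem_Icc_hasDerivWithinAt₀
  exact ⟨γ, h1, fun t ht => (h2 t (Ioo_subset_Icc_self ht)).hasDerivAt (Icc_mem_nhds ht.1 ht.2)⟩

/-- Every point of the plane lies on a complete integral curve of the vector field. -/
lemma exists_integralCurve (x : ℝ × ℝ) :
    ∃ γ : ℝ → ℝ × ℝ, γ 0 = x ∧ ∀ t, HasDerivAt γ (field P (γ t)) t := by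
  obtain ⟨K, hK⟩ := exists_lipschitz_field P
  choose γ h0 hγ using fun T : {T : ℝ // 0 < T} => exists_integralCurve_Icc P x T T.2
  have huniq : ∀ S T : {T : ℝ // 0 < T}, S ≤ T → EqOn (γ S) (γ T) (Ioo (-S.1) S.1) := by
    intro S T hST
    have hST' : S.1 ≤ T.1 := hST
    refine ODE_solution_unique_of_mem_Ioo (v := fun _ => field P) (s := fun _ => univ) (t₀ := 0)
      (K := K) (fun _ _ => hK.lipschitzOnWith) ⟨by linarith [S.2], S.2⟩
      (fun t ht => ⟨hγ S t ht, mem_univ _⟩)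
      (fun t ht => ⟨hγ T t ⟨by linarith [ht.1], by linarith [ht.2]⟩, mem_univ _⟩) ?_
    rw [h0, h0]
  have hp : ∀ t : ℝ, 0 < |t| + 1 := fun t => by positivity
  refine ⟨fun t => γ ⟨|t| + 1, hp t⟩ t, h0 _, fun t => ?_⟩
  have ht : t ∈ Ioo (-(|t| + 1)) (|t| + 1) := abs_lt.1 (by linarith)
  refine (hγ ⟨|t| + 1, hp t⟩ t ht).congr_of_eventuallyEq ?_
  filter_upwards [Ioo_mem_nhds ht.1 ht.2] with s hs
  have hs' : s ∈ Ioo (-(|s| + 1)) (|s| + 1) := abs_lt.1 (by linarith)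
  rcases le_total (|s| + 1) (|t| + 1) with h | h
  · exact huniq ⟨|s| + 1, hp s⟩ ⟨|t| + 1, hp t⟩ h hs'
  · exact (huniq ⟨|t| + 1, hp t⟩ ⟨|s| + 1, hp s⟩ h hs).symm

/-- The flow of the periodic vector field on the plane: `t ↦ flow P t x` is the integral curve
through `x`. -/
def flow (t : ℝ) (x : ℝ × ℝ) : ℝ × ℝ := (exists_integralCurve P x).choose t

lemma flow_zero (x : ℝ × ℝ) : flow P 0 x = x := (exists_integralCurve P x).choose_spec.1

lemma hasDerivAt_flow (x : ℝ × ℝ) (t : ℝ) :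
    HasDerivAt (fun s => flow P s x) (field P (flow P t x)) t :=
  (exists_integralCurve P x).choose_spec.2 t

lemma eq_flow {γ : ℝ → ℝ × ℝ} (hγ : ∀ t, HasDerivAt γ (field P (γ t)) t) (t : ℝ) :
    γ t = flow P t (γ 0) := by
  obtain ⟨K, hK⟩ := exists_lipschitz_field P
  exact congrFun (ODE_solution_unique_univ (v := fun _ => field P) (s := fun _ => univ) (t₀ := 0)
    (K := K) (fun _ => hK.lipschitzOnWith) (fun t => ⟨hγ t, mem_univ _⟩)
    (fun t => ⟨hasDerivAt_flow P (γ 0) t, mem_univ _⟩) (flow_zero P _).symm) t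

lemma flow_add (s t : ℝ) (x : ℝ × ℝ) : flow P (s + t) x = flow P s (flow P t x) := by
  have h := eq_flow P (γ := fun r => flow P (r + t) x)
    (fun r => (hasDerivAt_flow P x (r + t)).comp_add_const r t) s
  simpa using h

lemma flow_add_int (t : ℝ) (x : ℝ × ℝ) (m n : ℤ) :
    flow P t (x + ((m : ℝ), (n : ℝ))) = flow P t x + ((m : ℝ), (n : ℝ)) := by
  have h := eq_flow P (γ := fun r => flow P r x + ((m : ℝ), (n : ℝ)))
    (fun r => by rw [field_add_int]; exact (hasDerivAt_flow P x r).add_const _) t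
  simpa [flow_zero] using h.symm

lemma flow_neg (t : ℝ) (x : ℝ × ℝ) : flow P t (-x) = -flow P t x := by
  have h := eq_flow P (γ := fun r => -flow P r x)
    (fun r => by rw [field_neg]; exact (hasDerivAt_flow P x r).neg) t
  simpa [flow_zero] using h.symm

lemma continuous_flow_of_nonneg (t : ℝ) (ht : 0 ≤ t) : Continuous (flow P t) := by
  obtain ⟨K, hK⟩ := exists_lipschitz_field P
  refine LipschitzWith.continuous (K := Real.toNNReal (Real.exp (K * t)))
    (LipschitzWith.of_dist_le_mul fun x y => ?_)
  have hc : ∀ z, Continuous fun s => flow P s z := fun z =>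
    continuous_iff_continuousAt.2 fun s => (hasDerivAt_flow P z s).continuousAt
  have h := dist_le_of_trajectories_ODE (v := fun _ => field P) (K := K) (a := 0) (b := t)
    (f := fun s => flow P s x) (g := fun s => flow P s y) (δ := dist x y) (fun _ => hK)
    (hc x).continuousOn (fun s _ => (hasDerivAt_flow P x s).hasDerivWithinAt)
    (hc y).continuousOn (fun s _ => (hasDerivAt_flow P y s).hasDerivWithinAt)
    (by simp [flow_zero]) t ⟨ht, le_rfl⟩
  rw [Real.coe_toNNReal _ (Real.exp_pos _).le, mul_comm]
  simpa using h

lemma flow_neg_time (t : ℝ) (x : ℝ × ℝ) :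
    HasDerivAt (fun s => flow P (-s) x) (-field P (flow P (-t) x)) t := by
  have h := (hasDerivAt_flow P x (-t)).scomp t (hasDerivAt_neg t)
  rw [neg_one_smul] at h
  exact h

/-- The time-`t` map of the flow is continuous. -/
lemma continuous_flow (t : ℝ) : Continuous (flow P t) := by
  rcases le_total 0 t with ht | ht
  · exact continuous_flow_of_nonneg P t ht
  obtain ⟨K, hK⟩ := exists_lipschitz_field P
  refine LipschitzWith.continuous (K := Real.toNNReal (Real.exp (K * (-t))))
    (LipschitzWith.of_dist_le_mul fun x y => ?_)
  have hc : ∀ z, Continuous fun s => flow P (-s) z := fun z =>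
    continuous_iff_continuousAt.2 fun s => (flow_neg_time P s z).continuousAt
  have h := dist_le_of_trajectories_ODE (v := fun _ z => -field P z) (K := K) (a := 0) (b := -t)
    (f := fun s => flow P (-s) x) (g := fun s => flow P (-s) y) (δ := dist x y) (fun _ => hK.neg)
    (hc x).continuousOn (fun s _ => (flow_neg_time P s x).hasDerivWithinAt)
    (hc y).continuousOn (fun s _ => (flow_neg_time P s y).hasDerivWithinAt)
    (by simp [flow_zero]) (-t) ⟨by linarith, le_rfl⟩
  rw [Real.coe_toNNReal _ (Real.exp_pos _).le, mul_comm]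
  simpa using h

/-! ### The flow on the torus -/

lemma proj_surjective : Function.Surjective proj := by
  rintro ⟨p, q⟩
  obtain ⟨x, rfl⟩ := QuotientAddGroup.mk_surjective p
  obtain ⟨y, rfl⟩ := QuotientAddGroup.mk_surjective q
  exact ⟨(x, y), rfl⟩

lemma isOpenQuotientMap_proj : IsOpenQuotientMap proj :=
  QuotientAddGroup.isOpenQuotientMap_mk.prodMap QuotientAddGroup.isOpenQuotientMap_mk

lemma proj_neg (x : ℝ × ℝ) : proj (-x) = -proj x := rfl

lemma proj_add_int (x : ℝ × ℝ) (m n : ℤ) : proj (x + ((m : ℝ), (n : ℝ))) = proj x := by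
  have key : ∀ (a : ℝ) (k : ℤ), ((a + (k : ℝ) : ℝ) : UnitAddCircle) = a := by
    intro a k
    rw [AddCircle.coe_add, add_eq_left, AddCircle.coe_eq_zero_iff]
    exact ⟨k, by simp⟩
  exact Prod.ext (key _ _) (key _ _)

lemma exists_int_of_proj_eq {x y : ℝ × ℝ} (h : proj x = proj y) :
    ∃ m n : ℤ, x = y + ((m : ℝ), (n : ℝ)) := by
  have key : ∀ a b : ℝ, (a : UnitAddCircle) = b → ∃ k : ℤ, a = b + k := by
    intro a b hab
    have h0 : ((a - b : ℝ) : UnitAddCircle) = 0 := by rw [AddCircle.coe_sub, hab, sub_self]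
    obtain ⟨k, hk⟩ := (AddCircle.coe_eq_zero_iff 1).1 h0
    refine ⟨k, ?_⟩
    have : (k : ℝ) = a - b := by simpa using hk
    linarith
  obtain ⟨m, hm⟩ := key _ _ (congrArg Prod.fst h)
  obtain ⟨n, hn⟩ := key _ _ (congrArg Prod.snd h)
  exact ⟨m, n, Prod.ext hm hn⟩

/-- The time-`t` map of the flow on the torus, as a function. -/
def torusFlowFun (t : ℝ) (p : T2) : T2 := proj (flow P t (Function.surjInv proj_surjective p))

lemma torusFlowFun_proj (t : ℝ) (x : ℝ × ℝ) :
    torusFlowFun P t (proj x) = proj (flow P t x) := by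
  obtain ⟨m, n, h⟩ := exists_int_of_proj_eq (Function.surjInv_eq proj_surjective (proj x))
  rw [torusFlowFun, h, flow_add_int, proj_add_int]

lemma torusFlowFun_add (s t : ℝ) (p : T2) :
    torusFlowFun P s (torusFlowFun P t p) = torusFlowFun P (s + t) p := by
  obtain ⟨x, rfl⟩ := proj_surjective p
  rw [torusFlowFun_proj, torusFlowFun_proj, torusFlowFun_proj, flow_add]

lemma torusFlowFun_zero (p : T2) : torusFlowFun P 0 p = p := by
  obtain ⟨x, rfl⟩ := proj_surjective p
  rw [torusFlowFun_proj, flow_zero]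

lemma continuous_torusFlowFun (t : ℝ) : Continuous (torusFlowFun P t) := by
  rw [isOpenQuotientMap_proj.isQuotientMap.continuous_iff]
  have e : torusFlowFun P t ∘ proj = proj ∘ flow P t := funext (torusFlowFun_proj P t)
  rw [e]
  exact isOpenQuotientMap_proj.continuous.comp (continuous_flow P t)

/-- The time-`t` map `φ_t` of the flow of `v` on the torus. -/
def torusFlow (t : ℝ) : T2 ≃ₜ T2 where
  toFun := torusFlowFun P t
  invFun := torusFlowFun P (-t)
  left_inv p := by rw [torusFlowFun_add, neg_add_cancel, torusFlowFun_zero]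
  right_inv p := by rw [torusFlowFun_add, add_neg_cancel, torusFlowFun_zero]
  continuous_toFun := continuous_torusFlowFun P t
  continuous_invFun := continuous_torusFlowFun P (-t)

lemma torusFlow_proj (t : ℝ) (x : ℝ × ℝ) : torusFlow P t (proj x) = proj (flow P t x) :=
  torusFlowFun_proj P t x

/-! ### The derived-from-Anosov and the pseudo-DA homeomorphisms -/

/-- The derived-from-Anosov homeomorphism `f_DA = φ_τ ∘ g` of the torus. -/
def fDA : T2 ≃ₜ T2 := anosov.trans (torusFlow P P.τ)

lemma fDA_apply (p : T2) : fDA P p = torusFlow P P.τ (anosov p) := rfl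

lemma fDA_neg (p : T2) : fDA P (-p) = -fDA P p := by
  have h1 : anosov (-p) = -anosov p := by
    ext <;> simp only [anosov, Homeomorph.homeomorph_mk_coe, Equiv.coe_fn_mk, Prod.fst_neg,
      Prod.snd_neg] <;> abel
  rw [fDA_apply, fDA_apply, h1]
  obtain ⟨x, hx⟩ := proj_surjective (anosov p)
  rw [← hx, ← proj_neg, torusFlow_proj, torusFlow_proj, flow_neg, proj_neg]

lemma fDA_symm_neg (p : T2) : (fDA P).symm (-p) = -(fDA P).symm p := by
  rw [Homeomorph.symm_apply_eq, fDA_neg, Homeomorph.apply_symm_apply]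

/-- The map of the sphere induced by an odd map of the torus. -/
def descend (F : T2 → T2) (hF : ∀ p, F (-p) = -F p) : S2 → S2 :=
  Quotient.map F (by
    rintro p q (rfl | rfl)
    · exact Or.inl rfl
    · exact Or.inr (hF q))

lemma descend_quo (F : T2 → T2) (hF : ∀ p, F (-p) = -F p) (p : T2) :
    descend F hF (quo p) = quo (F p) := rfl

lemma continuous_descend {F : T2 → T2} (hF : ∀ p, F (-p) = -F p) (hc : Continuous F) :
    Continuous (descend F hF) :=
  isQuotientMap_quo.continuous_iff.2 (isQuotientMap_quo.continuous.comp hc)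

/-- The pseudo-DA homeomorphism `f_PDA` of the sphere, induced by `f_DA` on the antipodal
quotient. -/
def fPDA : S2 ≃ₜ S2 where
  toFun := descend (fDA P) (fDA_neg P)
  invFun := descend (fDA P).symm (fDA_symm_neg P)
  left_inv x := by
    obtain ⟨p, rfl⟩ := quo_surjective x
    rw [descend_quo, descend_quo, Homeomorph.symm_apply_apply]
  right_inv x := by
    obtain ⟨p, rfl⟩ := quo_surjective x
    rw [descend_quo, descend_quo, Homeomorph.apply_symm_apply]
  continuous_toFun := continuous_descend (fDA_neg P) (fDA P).continuous
  continuous_invFun := continuous_descend (fDA_symm_neg P) (fDA P).symm.continuous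

lemma fPDA_quo (p : T2) : fPDA P (quo p) = quo (fDA P p) := rfl

/-- The piece of the non-wandering set of `f_PDA` other than the repelling fixed point `π (0)`. -/
def pieceLambda : Set S2 := nonwanderingSet (fPDA P) \ {quo 0}

end PseudoDA

end

/-!
The whole argument takes place in the plane, for the lift `lift P` of the derived-from-Anosov map
`f`. In eigencoordinates `(u, s)` the lift multiplies `u` by `lam`, so it permutes the stable leaves
`u = const` of the linear map and preserves the order of each of them. Let `basin P` be the
preimage of the basin of repulsion of the source: the points whose backward orbit converges to a
lattice point (relative to the linear motion of that lattice point). Three facts carry the proof.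

*Contraction outside the basin* (`contraction`). On a leaf, near a lattice point, the flow is
multiplication by `exp E`, where the growth `E` decreases with `|u|` and with `|s|` because `δ` is
non-increasing (`IsGrowth.le_of_abs_le`). Hence a point which the lift does not move towards the
axis `s = 0` spans with the origin a rectangle that the inverse of the lift shrinks to the origin,
and so it lies in the basin; the only exception is the height of a fixed point on the leaf `u = 0`
(`mem_basinZero_or_fixed`), of which there is only one (`eq_of_fixed`), since the ball has room for
less than one fundamental domain of the linear map outside the plateau of `δ`. The lift therefore
strictly shortens every stable segment that misses the basin. By compactness of the torus, the
backward images of such a segment have unbounded length (`unbounded_back_segment`). No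
differentiability of the flow in the initial condition is needed.

*The attractor is the non-wandering set without the source* (`pieceLambda_eq_attractor`). The
lift is semiconjugate to the linear map by `(u, s) ↦ (u, height)`, where `height` is monotone on the
leaves. A fibre that misses the basin is a single point, by the first fact, and a point that is
alone in its fibre inherits the Poincaré recurrence of the linear map
(`mem_nonwanderingSet_of_height_lt`). The fibres that meet the basin have countably many heights,
so that every point outside the basin is a limit of points that are alone in their fibre
(`cov_mem_nonwanderingSet`). Conversely, the points of the basin other than the source wander,
because their backward orbits converge to the source, near which the lift is linear and expanding.
As the attractor is the complement of an open basin whose backward orbits converge to the source,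
it is isolated.

*Continua* (`cwExpansiveOn_attractor`). If all iterates of a nondegenerate continuum in the
attractor were small, a nondegenerate connected set over it in the torus would have small iterates
too (`exists_connected_lift`, `dist_le_of_dist_quo_le`). Expansion of `u` in the future would put
it in a single stable leaf, where it would be a segment that misses the basin and whose backward
images stay bounded.
-/

noncomputable section

namespace PseudoDA

variable (P : Data)

/-! ### Eigencoordinates of the plane -/

/-- The unstable eigenvalue `(3 + √5) / 2`. -/
def lam : ℝ := (3 + √5) / 2

/-- The stable eigenvalue `(3 - √5) / 2`. -/
def mu : ℝ := (3 - √5) / 2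

lemma sqrt_five_bounds : 2.2 < √5 ∧ √5 < 2.3 :=
  ⟨Real.lt_sqrt_of_sq_lt (by norm_num), (Real.sqrt_lt' (by norm_num)).2 (by norm_num)⟩

lemma lam_mul_mu : lam * mu = 1 := by
  have h5 : √5 * √5 = (5 : ℝ) := Real.mul_self_sqrt (by norm_num)
  rw [lam, mu]; linear_combination -h5 / 4

lemma one_lt_lam : 1 < lam := by
  have := sqrt_five_bounds.1
  rw [lam]; linarith

lemma lam_pos : 0 < lam := one_pos.trans one_lt_lam

lemma mu_pos : 0 < mu := by
  have := sqrt_five_bounds.2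
  rw [mu]; linarith

lemma mu_lt_half : mu < 1 / 2 := by
  have := sqrt_five_bounds.1
  rw [mu]; linarith

lemma mu_lt_one : mu < 1 := mu_lt_half.trans (by norm_num)

lemma lam_mul_mu_mul (t : ℝ) : lam * (mu * t) = t := by rw [← mul_assoc, lam_mul_mu, one_mul]

lemma mu_mul_lam_mul (t : ℝ) : mu * (lam * t) = t := by
  rw [← mul_assoc, mul_comm mu, lam_mul_mu, one_mul]

/-- The point with eigencoordinates `u` and `s`. -/
def pt (u s : ℝ) : ℝ × ℝ := u • vu + s • vs

lemma pt_coord (x : ℝ × ℝ) : pt (coordU x) (coordS x) = x := coordU_smul_add_coordS_smul x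

@[simp] lemma coordU_pt (u s : ℝ) : coordU (pt u s) = u := by
  have h := inv_sqrt_sq
  simp only [pt, coordU, vu, vs, Prod.smul_fst, Prod.smul_snd, Prod.fst_add, Prod.snd_add,
    smul_eq_mul]
  linear_combination u * h

@[simp] lemma coordS_pt (u s : ℝ) : coordS (pt u s) = s := by
  have h := inv_sqrt_sq
  simp only [pt, coordS, vu, vs, Prod.smul_fst, Prod.smul_snd, Prod.fst_add, Prod.snd_add,
    smul_eq_mul]
  linear_combination s * h

lemma ext_coord {x y : ℝ × ℝ} (hu : coordU x = coordU y) (hs : coordS x = coordS y) : x = y := by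
  rw [← pt_coord x, ← pt_coord y, hu, hs]

lemma coordU_add (x y : ℝ × ℝ) : coordU (x + y) = coordU x + coordU y := by
  simp [coordU]; ring

lemma coordS_add (x y : ℝ × ℝ) : coordS (x + y) = coordS x + coordS y := by
  simp [coordS]; ring

@[simp] lemma coordU_neg (x : ℝ × ℝ) : coordU (-x) = -coordU x := by simp [coordU]; ring

@[simp] lemma coordS_neg (x : ℝ × ℝ) : coordS (-x) = -coordS x := by simp [coordS]; ring

@[simp] lemma coordU_zero : coordU 0 = 0 := by simp [coordU]

@[simp] lemma coordS_zero : coordS 0 = 0 := by simp [coordS]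

lemma coordU_smul_vs (c : ℝ) : coordU (c • vs) = 0 := by
  have := coordU_pt 0 c; simpa [pt] using this

lemma coordS_smul_vs (c : ℝ) : coordS (c • vs) = c := by
  have := coordS_pt 0 c; simpa [pt] using this

lemma pt_zero_zero : pt 0 0 = 0 := by simp [pt]

lemma continuous_coordU : Continuous coordU := by unfold coordU; fun_prop

lemma continuous_coordS : Continuous coordS := by unfold coordS; fun_prop

lemma continuous_pt : Continuous fun q : ℝ × ℝ => pt q.1 q.2 := by unfold pt; fun_prop

lemma norm_vu_le : ‖vu‖ ≤ 1 := by
  obtain ⟨h1, h2⟩ := abs_inv_sqrt_le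
  rw [Prod.norm_def]
  refine max_le ?_ ?_
  · rw [vu, Prod.smul_fst, smul_eq_mul]; exact h2
  · rw [vu, Prod.smul_snd, smul_eq_mul, mul_one]; exact h1

lemma norm_pt_le (u s : ℝ) : ‖pt u s‖ ≤ |u| + |s| := by
  refine (norm_add_le _ _).trans (add_le_add ?_ ?_)
  · rw [norm_smul, Real.norm_eq_abs]
    exact mul_le_of_le_one_right (abs_nonneg _) norm_vu_le
  · rw [norm_smul, Real.norm_eq_abs]
    exact mul_le_of_le_one_right (abs_nonneg _) norm_vs_le

lemma norm_le_coord (x : ℝ × ℝ) : ‖x‖ ≤ |coordU x| + |coordS x| := by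
  simpa only [pt_coord] using norm_pt_le (coordU x) (coordS x)

/-! ### The lift of the derived-from-Anosov map to the plane -/

/-- The linear map `(x, y) ↦ (2 x + y, x + y)` of the plane. -/
def linA : (ℝ × ℝ) ≃ₜ (ℝ × ℝ) where
  toFun p := (2 * p.1 + p.2, p.1 + p.2)
  invFun p := (p.1 - p.2, 2 * p.2 - p.1)
  left_inv p := by ext <;> simp only <;> ring
  right_inv p := by ext <;> simp only <;> ring
  continuous_toFun := by fun_prop
  continuous_invFun := by fun_prop

lemma linA_apply (x : ℝ × ℝ) : linA x = (2 * x.1 + x.2, x.1 + x.2) := rfl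

lemma linA_symm_apply (x : ℝ × ℝ) : linA.symm x = (x.1 - x.2, 2 * x.2 - x.1) := rfl

@[simp] lemma coordU_linA (x : ℝ × ℝ) : coordU (linA x) = lam * coordU x := by
  have h1 := congrArg Prod.fst vu_eigen
  have h2 := congrArg Prod.snd vu_eigen
  simp only [Prod.smul_fst, Prod.smul_snd, smul_eq_mul] at h1 h2
  simp only [linA_apply, coordU, lam]
  linear_combination x.1 * h1 + x.2 * h2

@[simp] lemma coordS_linA (x : ℝ × ℝ) : coordS (linA x) = mu * coordS x := by
  have h1 := congrArg Prod.fst vs_eigen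
  have h2 := congrArg Prod.snd vs_eigen
  simp only [Prod.smul_fst, Prod.smul_snd, smul_eq_mul] at h1 h2
  simp only [linA_apply, coordS, mu]
  linear_combination x.1 * h1 + x.2 * h2

@[simp] lemma coordU_linA_symm (x : ℝ × ℝ) : coordU (linA.symm x) = mu * coordU x := by
  have h := coordU_linA (linA.symm x)
  rw [linA.apply_symm_apply] at h
  rw [h, mu_mul_lam_mul]

@[simp] lemma coordS_linA_symm (x : ℝ × ℝ) : coordS (linA.symm x) = lam * coordS x := by
  have h := coordS_linA (linA.symm x)
  rw [linA.apply_symm_apply] at h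
  rw [h, lam_mul_mu_mul]

/-- The point of `ℝ²` with integer coordinates `m`. -/
def ivec (m : ℤ × ℤ) : ℝ × ℝ := ((m.1 : ℝ), (m.2 : ℝ))

@[simp] lemma ivec_zero : ivec 0 = 0 := by simp [ivec]

lemma ivec_add (m n : ℤ × ℤ) : ivec (m + n) = ivec m + ivec n := by simp [ivec]

lemma ivec_neg (m : ℤ × ℤ) : ivec (-m) = -ivec m := by simp [ivec]

lemma ivec_sub (m n : ℤ × ℤ) : ivec (m - n) = ivec m - ivec n := by simp [ivec]

lemma linA_ivec (m : ℤ × ℤ) : linA (ivec m) = ivec (2 * m.1 + m.2, m.1 + m.2) := by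
  simp [ivec, linA_apply]

lemma linA_symm_ivec (m : ℤ × ℤ) : linA.symm (ivec m) = ivec (m.1 - m.2, 2 * m.2 - m.1) := by
  simp [ivec, linA_symm_apply]

lemma linA_add (x y : ℝ × ℝ) : linA (x + y) = linA x + linA y := by
  simp only [linA_apply, Prod.mk_add_mk, Prod.fst_add, Prod.snd_add]
  ext <;> simp only <;> ring

lemma linA_neg (x : ℝ × ℝ) : linA (-x) = -linA x := by
  simp only [linA_apply, Prod.neg_mk, Prod.fst_neg, Prod.snd_neg]
  ext <;> simp only <;> ring

lemma linA_symm_add (x y : ℝ × ℝ) : linA.symm (x + y) = linA.symm x + linA.symm y := by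
  rw [Homeomorph.symm_apply_eq, linA_add]; simp

/-- The time-`t` map of the flow of the plane. -/
def planeFlow (t : ℝ) : (ℝ × ℝ) ≃ₜ (ℝ × ℝ) where
  toFun := flow P t
  invFun := flow P (-t)
  left_inv x := by rw [← flow_add, neg_add_cancel, flow_zero]
  right_inv x := by rw [← flow_add, add_neg_cancel, flow_zero]
  continuous_toFun := continuous_flow P t
  continuous_invFun := continuous_flow P (-t)

/-- The lift of the derived-from-Anosov map to the plane. -/
def lift : (ℝ × ℝ) ≃ₜ (ℝ × ℝ) := linA.trans (planeFlow P P.τ)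

lemma lift_apply (x : ℝ × ℝ) : lift P x = flow P P.τ (linA x) := rfl

lemma lift_symm_apply (x : ℝ × ℝ) : (lift P).symm x = linA.symm (flow P (-P.τ) x) := rfl

lemma proj_lift (x : ℝ × ℝ) : proj (lift P x) = fDA P (proj x) := by
  rw [lift_apply, fDA_apply, ← torusFlow_proj]
  congr 1
  ext <;> simp [proj, linA_apply, anosov, two_mul]

lemma flow_add_ivec (t : ℝ) (x : ℝ × ℝ) (m : ℤ × ℤ) :
    flow P t (x + ivec m) = flow P t x + ivec m := flow_add_int P t x m.1 m.2

lemma lift_add_ivec (x : ℝ × ℝ) (m : ℤ × ℤ) :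
    lift P (x + ivec m) = lift P x + linA (ivec m) := by
  rw [lift_apply, lift_apply, linA_add, linA_ivec, flow_add_ivec]

lemma lift_symm_add_ivec (x : ℝ × ℝ) (m : ℤ × ℤ) :
    (lift P).symm (x + ivec m) = (lift P).symm x + linA.symm (ivec m) := by
  rw [lift_symm_apply, lift_symm_apply, flow_add_ivec, linA_symm_add]

lemma lift_neg (x : ℝ × ℝ) : lift P (-x) = -lift P x := by
  rw [lift_apply, lift_apply, linA_neg, flow_neg]

lemma lift_symm_neg (x : ℝ × ℝ) : (lift P).symm (-x) = -(lift P).symm x := by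
  rw [Homeomorph.symm_apply_eq, lift_neg, Homeomorph.apply_symm_apply]

/-! ### The flow along the stable leaves -/

lemma tau_pos : 0 < P.τ := by
  by_contra h
  have h1 := P.τ_large
  have h2 : Real.exp P.τ ≤ 1 := Real.exp_le_one_iff.2 (not_lt.1 h)
  have h3 := mu_lt_one
  have h4 := mu_pos
  rw [mu] at h3 h4
  nlinarith

lemma lam_lt_exp_tau : lam < Real.exp P.τ := by
  have h1 : 1 < Real.exp P.τ * mu := P.τ_large
  have := lam_mul_mu
  have := mu_pos
  nlinarith

lemma hasDerivAt_coordU {γ : ℝ → ℝ × ℝ} {v : ℝ × ℝ} {t : ℝ} (h : HasDerivAt γ v t) :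
    HasDerivAt (fun r => coordU (γ r)) (coordU v) t := by
  have h1 := ((ContinuousLinearMap.fst ℝ ℝ ℝ).hasFDerivAt.comp_hasDerivAt t h).mul_const vu.1
  have h2 := ((ContinuousLinearMap.snd ℝ ℝ ℝ).hasFDerivAt.comp_hasDerivAt t h).mul_const vu.2
  exact h1.add h2

lemma hasDerivAt_coordS {γ : ℝ → ℝ × ℝ} {v : ℝ × ℝ} {t : ℝ} (h : HasDerivAt γ v t) :
    HasDerivAt (fun r => coordS (γ r)) (coordS v) t := by
  have h1 := ((ContinuousLinearMap.fst ℝ ℝ ℝ).hasFDerivAt.comp_hasDerivAt t h).mul_const vs.1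
  have h2 := ((ContinuousLinearMap.snd ℝ ℝ ℝ).hasFDerivAt.comp_hasDerivAt t h).mul_const vs.2
  exact h1.add h2

lemma coordU_bumpField (x : ℝ × ℝ) : coordU (bumpField P x) = 0 := coordU_smul_vs _

lemma coordS_bumpField (x : ℝ × ℝ) : coordS (bumpField P x) =
    coordS x * P.δ (√(coordU x ^ 2 + coordS x ^ 2)) := coordS_smul_vs _

lemma coordU_field (x : ℝ × ℝ) : coordU (field P x) = 0 := coordU_bumpField P _

@[simp] lemma coordU_flow (t : ℝ) (x : ℝ × ℝ) : coordU (flow P t x) = coordU x := by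
  have h : ∀ r, HasDerivAt (fun r => coordU (flow P r x)) 0 r := fun r => by
    have := hasDerivAt_coordU (hasDerivAt_flow P x r)
    rwa [coordU_field] at this
  have := is_const_of_deriv_eq_zero (fun r => (h r).differentiableAt) (fun r => (h r).deriv) t 0
  simpa [flow_zero] using this

@[simp] lemma coordU_lift (x : ℝ × ℝ) : coordU (lift P x) = lam * coordU x := by
  rw [lift_apply, coordU_flow, coordU_linA]

@[simp] lemma coordU_lift_symm (x : ℝ × ℝ) : coordU ((lift P).symm x) = mu * coordU x := by
  rw [lift_symm_apply, coordU_linA_symm, coordU_flow]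

lemma continuous_flow_time (x : ℝ × ℝ) : Continuous fun t => flow P t x :=
  continuous_iff_continuousAt.2 fun t => (hasDerivAt_flow P x t).continuousAt

lemma flow_injective (t : ℝ) : Function.Injective (flow P t) := (planeFlow P t).injective

/-- The flow preserves the order of every stable leaf, as integral curves do not cross. -/
lemma coordS_flow_lt {x y : ℝ × ℝ} (hu : coordU x = coordU y) (hs : coordS x < coordS y) (t : ℝ) :
    coordS (flow P t x) < coordS (flow P t y) := by
  by_contra h
  have hc : Continuous fun r => coordS (flow P r y) - coordS (flow P r x) :=
    (continuous_coordS.comp (continuous_flow_time P y)).sub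
      (continuous_coordS.comp (continuous_flow_time P x))
  obtain ⟨r, hr⟩ : (0 : ℝ) ∈ range fun r => coordS (flow P r y) - coordS (flow P r x) :=
    mem_range_of_exists_le_of_exists_ge hc ⟨t, by simpa using h⟩
      ⟨0, by simpa [flow_zero] using hs.le⟩
  have e : flow P r x = flow P r y := ext_coord (by simp [hu]) (by linarith [sub_eq_zero.1 hr])
  exact hs.ne (congrArg coordS (flow_injective P r e))

lemma coordS_lift_symm_lt {x y : ℝ × ℝ} (hu : coordU x = coordU y) (hs : coordS x < coordS y) :
    coordS ((lift P).symm x) < coordS ((lift P).symm y) := by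
  rw [lift_symm_apply, lift_symm_apply, coordS_linA_symm, coordS_linA_symm]
  exact mul_lt_mul_of_pos_left (coordS_flow_lt P hu hs _) lam_pos

lemma coordS_lift_symm_le {x y : ℝ × ℝ} (hu : coordU x = coordU y) (hs : coordS x ≤ coordS y) :
    coordS ((lift P).symm x) ≤ coordS ((lift P).symm y) := by
  rcases hs.eq_or_lt with h | h
  · rw [ext_coord hu h]
  · exact (coordS_lift_symm_lt P hu h).le

lemma flow_of_field_eq_zero {x : ℝ × ℝ} (h : field P x = 0) (t : ℝ) : flow P t x = x :=
  (eq_flow P (γ := fun _ => x) (fun t => by rw [h]; exact hasDerivAt_const t x) t).symm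

lemma field_flow_ne_zero {x : ℝ × ℝ} (h : field P x ≠ 0) (t : ℝ) : field P (flow P t x) ≠ 0 := by
  intro h0
  have h1 := flow_of_field_eq_zero P h0 (-t)
  rw [← flow_add, neg_add_cancel, flow_zero] at h1
  exact h (h1 ▸ h0)

lemma field_eq_bumpField_of_ne {x : ℝ × ℝ} (h : bumpField P x ≠ 0) : field P x = bumpField P x := by
  have := field_eq_of_ne P (x := x) 0 0
  simp only [Int.cast_zero, Prod.mk_zero_zero, sub_zero] at this
  exact this h

lemma field_eq_bumpField_of_lt {x : ℝ × ℝ} (h : coordU x ^ 2 + coordS x ^ 2 < P.r₀ ^ 2) :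
    field P x = bumpField P x := by
  rw [coord_sq] at h
  have h2 : P.r₀ ^ 2 ≤ (1 / 2) ^ 2 := pow_le_pow_left₀ P.r₀_pos.le P.r₀_le 2
  have h3 : |x.1| < 1 / 2 := abs_lt_of_sq_lt_sq (by nlinarith [sq_nonneg x.2]) (by norm_num)
  have h4 : |x.2| < 1 / 2 := abs_lt_of_sq_lt_sq (by nlinarith [sq_nonneg x.1]) (by norm_num)
  have key : ∀ y : ℝ, |y| < 1 / 2 → round y = 0 := by
    intro y hk
    rw [abs_lt] at hk
    rw [round_eq_zero_iff]
    constructor <;> linarith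
  simp [field, centred, key _ h3, key _ h4]

lemma continuous_bumpField : Continuous (bumpField P) := by
  obtain ⟨K, -, hK⟩ := exists_lipschitz_bumpField P
  refine LipschitzWith.continuous (K := Real.toNNReal (max K 0)) (LipschitzWith.of_dist_le_mul
    fun x y => ?_)
  rw [dist_eq_norm, dist_eq_norm, Real.coe_toNNReal _ (le_max_right _ _)]
  exact (hK x y).trans (mul_le_mul_of_nonneg_right (le_max_left _ _) (norm_nonneg _))

lemma continuous_field : Continuous (field P) := (exists_lipschitz_field P).choose_spec.continuous

/-- Along an integral curve, the periodic field agrees with its summand at the origin at all times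
as soon as it does at one time. -/
lemma field_flow_eq_bumpField {x : ℝ × ℝ} (h : field P x = bumpField P x) (t : ℝ) :
    field P (flow P t x) = bumpField P (flow P t x) := by
  by_cases h0 : field P x = 0
  · rw [flow_of_field_eq_zero P h0, h]
  have hset : {r | field P (flow P r x) = bumpField P (flow P r x)} =
      {r | bumpField P (flow P r x) ≠ 0} := by
    ext r
    exact ⟨fun hr h1 => field_flow_ne_zero P h0 r
      ((show field P (flow P r x) = _ from hr).trans h1),
      field_eq_bumpField_of_ne P⟩
  have hclo : IsClopen {r | field P (flow P r x) = bumpField P (flow P r x)} := by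
    refine ⟨isClosed_eq ((continuous_field P).comp (continuous_flow_time P x))
      ((continuous_bumpField P).comp (continuous_flow_time P x)), ?_⟩
    rw [hset]
    exact isOpen_ne_fun ((continuous_bumpField P).comp (continuous_flow_time P x)) continuous_const
  have := hclo.eq_univ ⟨0, by simpa [flow_zero] using h⟩
  exact (this ▸ mem_univ t : t ∈ {r | field P (flow P r x) = bumpField P (flow P r x)})

/-! ### Growth along the stable leaves near the origin -/

/-- `E` is the logarithmic growth of the solution of `S' = S δ(√(u² + S²))` with `S 0 = s`: this
solution is `S t = s * exp (E t)`. -/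
def IsGrowth (u s : ℝ) (E : ℝ → ℝ) : Prop :=
  E 0 = 0 ∧ ∀ t, HasDerivAt E (P.δ (√(u ^ 2 + (s * Real.exp (E t)) ^ 2))) t

lemma continuous_bump_radius : Continuous fun x : ℝ × ℝ => P.δ (√(coordU x ^ 2 + coordS x ^ 2)) :=
  P.δ_smooth.continuous.comp (Real.continuous_sqrt.comp
    ((continuous_coordU.pow 2).add (continuous_coordS.pow 2)))

lemma exists_growth {x : ℝ × ℝ} (h : field P x = bumpField P x) :
    ∃ E, IsGrowth P (coordU x) (coordS x) E ∧
      ∀ t, coordS (flow P t x) = coordS x * Real.exp (E t) := by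
  set w : ℝ → ℝ := fun t => P.δ (√(coordU (flow P t x) ^ 2 + coordS (flow P t x) ^ 2)) with hw
  have hwc : Continuous w := (continuous_bump_radius P).comp (continuous_flow_time P x)
  set E : ℝ → ℝ := fun t => ∫ r in (0 : ℝ)..t, w r with hE
  have hE' : ∀ t, HasDerivAt E (w t) t := fun t => (hwc.integral_hasStrictDerivAt 0 t).hasDerivAt
  have hE0 : E 0 = 0 := intervalIntegral.integral_same
  have hS : ∀ t, HasDerivAt (fun r => coordS (flow P r x)) (coordS (flow P t x) * w t) t := by
    intro t
    have := hasDerivAt_coordS (hasDerivAt_flow P x t)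
    rwa [field_flow_eq_bumpField P h, coordS_bumpField] at this
  have hD : ∀ t, HasDerivAt (fun r => coordS (flow P r x) * Real.exp (-E r)) 0 t := by
    intro t
    have h1 : HasDerivAt (fun r => coordS (flow P r x) * Real.exp (-E r)) _ t :=
      (hS t).mul ((hE' t).neg.exp)
    refine h1.congr_deriv ?_
    simp only [Pi.neg_apply]
    ring
  have hsol : ∀ t, coordS (flow P t x) = coordS x * Real.exp (E t) := by
    intro t
    have := is_const_of_deriv_eq_zero (fun r => (hD r).differentiableAt) (fun r => (hD r).deriv) t 0
    simp only [flow_zero, hE0, neg_zero, Real.exp_zero, mul_one] at this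
    rw [← this, mul_assoc, ← Real.exp_add, neg_add_cancel, Real.exp_zero, mul_one]
  refine ⟨E, ⟨hE0, fun t => ?_⟩, hsol⟩
  have := hE' t
  simp only [hw, coordU_flow, hsol] at this
  exact this

lemma nonneg_of_deriv_nonneg_of_neg {D D' : ℝ → ℝ} (hD : ∀ t, HasDerivAt D (D' t) t)
    (h0 : D 0 = 0) (h : ∀ t, D t < 0 → 0 ≤ D' t) {t : ℝ} (ht : 0 ≤ t) : 0 ≤ D t := by
  by_contra hneg
  have hc : Continuous D := continuous_iff_continuousAt.2 fun r => (hD r).continuousAt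
  have hK : IsCompact (Icc 0 t ∩ {r | 0 ≤ D r}) :=
    isCompact_Icc.inter_right (isClosed_le continuous_const hc)
  obtain ⟨r, ⟨hr, hr0⟩, hmax⟩ := hK.exists_isGreatest ⟨0, ⟨le_rfl, ht⟩, h0.ge⟩
  have hmono : MonotoneOn D (Icc r t) := by
    refine monotoneOn_of_deriv_nonneg (convex_Icc r t) hc.continuousOn
      (fun q _ => (hD q).differentiableAt.differentiableWithinAt) fun q hq => ?_
    rw [interior_Icc] at hq
    rw [(hD q).deriv]
    refine h q (not_le.1 fun hq0 => ?_)
    exact absurd (hmax ⟨⟨hr.1.trans hq.1.le, hq.2.le⟩, hq0⟩) (not_le.2 hq.1)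
  exact hneg ((show 0 ≤ D r from hr0).trans (hmono ⟨le_rfl, hr.2⟩ ⟨hr.2, le_rfl⟩ hr.2))

variable {P}

lemma IsGrowth.differentiable {u s : ℝ} {E : ℝ → ℝ} (h : IsGrowth P u s E) : Differentiable ℝ E :=
  fun t => (h.2 t).differentiableAt

lemma IsGrowth.monotone {u s : ℝ} {E : ℝ → ℝ} (h : IsGrowth P u s E) : Monotone E :=
  monotone_of_deriv_nonneg h.differentiable fun t => by rw [(h.2 t).deriv]; exact (P.δ_mem _).1

/-- The growth is larger on trajectories that start closer to the origin, as the bump function is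
non-increasing. -/
lemma IsGrowth.le_of_abs_le {u₁ s₁ u₂ s₂ : ℝ} {E₁ E₂ : ℝ → ℝ} (h₁ : IsGrowth P u₁ s₁ E₁)
    (h₂ : IsGrowth P u₂ s₂ E₂) (hu : |u₁| ≤ |u₂|) (hs : |s₁| ≤ |s₂|) {t : ℝ} (ht : 0 ≤ t) :
    E₂ t ≤ E₁ t := by
  refine sub_nonneg.1 (nonneg_of_deriv_nonneg_of_neg (D := fun t => E₁ t - E₂ t)
    (fun t => (h₁.2 t).sub (h₂.2 t)) (by simp [h₁.1, h₂.1]) (fun r hr => ?_) ht)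
  refine sub_nonneg.2 (P.δ_antitone (Real.sqrt_le_sqrt ?_))
  have h3 : Real.exp (E₁ r) ≤ Real.exp (E₂ r) := Real.exp_le_exp.2 (by linarith [hr])
  refine add_le_add (sq_le_sq.2 hu) (sq_le_sq.2 ?_)
  rw [abs_mul, abs_mul, Real.abs_exp, Real.abs_exp]
  exact mul_le_mul hs h3 (Real.exp_pos _).le (abs_nonneg _)

variable (P)

/-- If the trajectory from `linA x` to `lift P x` is one of the summand of the field at the
origin, then the lift acts on the stable coordinate by the growth of this trajectory. -/
lemma coordS_lift_eq {x : ℝ × ℝ} (h : field P (linA x) = bumpField P (linA x)) :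
    ∃ E, IsGrowth P (lam * coordU x) (mu * coordS x) E ∧
      coordS (lift P x) = mu * Real.exp (E P.τ) * coordS x := by
  obtain ⟨E, hE, h2⟩ := exists_growth P h
  rw [coordU_linA, coordS_linA] at hE
  refine ⟨E, hE, ?_⟩
  rw [lift_apply, h2, coordS_linA]
  ring

/-! ### The fixed point on the positive half of the stable leaf of the origin -/

lemma exists_plateau_end : ∃ R, P.r₀ / 2 ≤ R ∧ R < P.r₀ ∧ ∀ r, P.δ r = 1 ↔ r ≤ R := by
  have hne : ({r | P.δ r = 1} : Set ℝ).Nonempty := ⟨P.r₀ / 2, P.δ_eq_one _ le_rfl⟩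
  have hlt : ∀ r, P.δ r = 1 → r < P.r₀ := fun r hr => not_le.1 fun h => by
    rw [P.δ_eq_zero r h] at hr; norm_num at hr
  have hbd : BddAbove {r | P.δ r = 1} := ⟨P.r₀, fun r hr => (hlt r hr).le⟩
  have hcl : IsClosed {r | P.δ r = 1} := isClosed_eq P.δ_smooth.continuous continuous_const
  have hmem : P.δ (sSup {r | P.δ r = 1}) = 1 := hcl.csSup_mem hne hbd
  refine ⟨sSup {r | P.δ r = 1}, le_csSup hbd (P.δ_eq_one _ le_rfl), hlt _ hmem, fun r =>
    ⟨fun hr => le_csSup hbd hr, fun hr => le_antisymm (P.δ_mem r).2 ?_⟩⟩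
  exact hmem ▸ P.δ_antitone hr

/-- On the stable leaf of the origin, at most one fixed point of the lift lies on either side of
the origin in the ball. Two of them would have the same growth up to time `τ`, hence the same
growth at all times in between; when the inner trajectory reaches the end of the plateau
`{δ = 1}`, the outer one is past it and grows more slowly. -/
lemma eq_of_fixed {a b : ℝ} (ha : 0 < a) (hab : a ≤ b) (hb : b < P.r₀)
    (hfa : lift P (pt 0 a) = pt 0 a) (hfb : lift P (pt 0 b) = pt 0 b) : a = b := by
  by_contra hne
  have hlt : a < b := lt_of_le_of_ne hab hne
  have hτ := tau_pos P
  have hμ := mu_pos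
  have hmem : ∀ c, 0 < c → c < P.r₀ → field P (linA (pt 0 c)) = bumpField P (linA (pt 0 c)) := by
    intro c hc hcr
    refine field_eq_bumpField_of_lt P ?_
    rw [coordU_linA, coordS_linA, coordU_pt, coordS_pt]
    have h1 : mu * c < P.r₀ := by nlinarith [mu_lt_one]
    have h2 : 0 < mu * c := by positivity
    nlinarith
  obtain ⟨E, hE, hE2⟩ := exists_growth P (hmem a ha (hlt.trans hb))
  obtain ⟨G, hG, hG2⟩ := exists_growth P (hmem b (ha.trans hlt) hb)
  simp only [coordU_linA, coordS_linA, coordU_pt, coordS_pt, mul_zero] at hE hE2 hG hG2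
  have hend : ∀ (c : ℝ) (K : ℝ → ℝ), 0 < c → lift P (pt 0 c) = pt 0 c →
      (∀ t, coordS (flow P t (linA (pt 0 c))) = mu * c * Real.exp (K t)) →
      Real.exp (K P.τ) = lam := by
    intro c K hc hf hK
    have h1 := hK P.τ
    rw [← lift_apply, hf, coordS_pt] at h1
    have h2 : c * (mu * Real.exp (K P.τ)) = c * 1 := by linarith
    have h3 := mul_left_cancel₀ hc.ne' h2
    rw [← mul_one lam, ← h3, lam_mul_mu_mul]
  have heE := hend a E ha hfa hE2
  have heG := hend b G (ha.trans hlt) hfb hG2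
  have hcross : ∀ t, mu * a * Real.exp (E t) < mu * b * Real.exp (G t) := by
    intro t
    rw [← hE2, ← hG2]
    exact coordS_flow_lt P (by simp) (by simpa using mul_lt_mul_of_pos_left hlt hμ) t
  have hpos : ∀ t, 0 < mu * a * Real.exp (E t) := fun t => by positivity
  have hrad : ∀ s : ℝ, 0 < s → √(0 ^ 2 + s ^ 2) = s := fun s hs => by
    rw [zero_pow two_ne_zero, zero_add, Real.sqrt_sq hs.le]
  have hE' : ∀ t, HasDerivAt E (P.δ (mu * a * Real.exp (E t))) t := fun t => by
    have := hE.2 t; rwa [hrad _ (hpos t)] at this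
  have hG' : ∀ t, HasDerivAt G (P.δ (mu * b * Real.exp (G t))) t := fun t => by
    have := hG.2 t; rwa [hrad _ ((hpos t).trans (hcross t))] at this
  have hDmono : Monotone fun t => E t - G t :=
    monotone_of_deriv_nonneg (hE.differentiable.sub hG.differentiable) fun t => by
      have h : HasDerivAt (fun t => E t - G t) _ t := (hE' t).sub (hG' t)
      rw [h.deriv, sub_nonneg]
      exact P.δ_antitone (hcross t).le
  have hDeq : ∀ t ∈ Icc 0 P.τ, E t - G t = 0 := by
    intro t ht
    have h1 := hDmono ht.1
    have h2 := hDmono ht.2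
    have h3 : E P.τ = G P.τ := Real.exp_injective (heE.trans heG.symm)
    simp only [hE.1, hG.1, h3, sub_self] at h1 h2
    exact le_antisymm h2 h1
  obtain ⟨R, hR1, hR2, hR⟩ := exists_plateau_end P
  have hstart : mu * a < R := by nlinarith [mu_lt_half]
  have hfin : mu * a * Real.exp (E P.τ) = a := by
    rw [heE]; linear_combination a * lam_mul_mu
  by_cases haR : a ≤ R
  · -- the inner trajectory stays in the plateau, where it grows like `exp t`
    have hone : ∀ t ∈ Icc 0 P.τ, HasDerivAt E 1 t := by
      intro t ht
      have h1 : mu * a * Real.exp (E t) ≤ R := by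
        refine le_trans ?_ (hfin.le.trans haR)
        exact mul_le_mul_of_nonneg_left (Real.exp_le_exp.2 (hE.monotone ht.2)) (by positivity)
      have := hE' t
      rwa [(hR _).2 h1] at this
    have hEτ : E P.τ = P.τ := by
      have := constant_of_has_deriv_right_zero (f := fun t => E t - t) (a := 0) (b := P.τ)
        (hE.differentiable.continuous.sub continuous_id).continuousOn
        (fun t ht => by
          have h : HasDerivAt (fun t => E t - t) (1 - 1) t :=
            (hone t ⟨ht.1, ht.2.le⟩).sub (hasDerivAt_id t)
          rw [sub_self] at h
          exact h.hasDerivWithinAt) P.τ ⟨hτ.le, le_rfl⟩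
      simp only [hE.1, sub_zero] at this
      linarith
    rw [hEτ] at heE
    exact (lam_lt_exp_tau P).ne' heE
  · have hc : ContinuousOn (fun t => mu * a * Real.exp (E t)) (Icc 0 P.τ) :=
      (continuous_const.mul (Real.continuous_exp.comp hE.differentiable.continuous)).continuousOn
    obtain ⟨t, ht, hteq⟩ := intermediate_value_Icc hτ.le hc
      (show R ∈ Icc _ _ from ⟨by simpa [hE.1] using hstart.le, by rw [hfin]; linarith⟩)
    have ht0 : t ≠ 0 := by
      rintro rfl
      simp only [hE.1, Real.exp_zero, mul_one] at hteq
      linarith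
    have ht1 : t ≠ P.τ := by
      rintro rfl
      rw [show mu * a * Real.exp (E P.τ) = R from hteq] at hfin
      exact haR hfin.ge
    have hnhds : (fun r => E r - G r) =ᶠ[𝓝 t] fun _ => 0 := by
      filter_upwards [Icc_mem_nhds (lt_of_le_of_ne ht.1 ht0.symm) (lt_of_le_of_ne ht.2 ht1)]
        with r hr using hDeq r hr
    have h1 := ((hE' t).sub (hG' t)).unique ((hasDerivAt_const t (0 : ℝ)).congr_of_eventuallyEq
      hnhds)
    have h2 : P.δ (mu * a * Real.exp (E t)) = 1 := (hR _).2 hteq.le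
    have h3 : P.δ (mu * b * Real.exp (G t)) = 1 := by linarith
    have h4 := (hR _).1 h3
    have h5 := hcross t
    rw [show mu * a * Real.exp (E t) = R from hteq] at h5
    linarith

/-! ### The basin of the source -/

/-- The `k`-th iterate of the inverse of the lift. -/
def back (k : ℕ) (x : ℝ × ℝ) : ℝ × ℝ := (lift P).symm^[k] x

@[simp] lemma back_zero (x : ℝ × ℝ) : back P 0 x = x := rfl

lemma back_succ (k : ℕ) (x : ℝ × ℝ) : back P (k + 1) x = (lift P).symm (back P k x) :=
  Function.iterate_succ_apply' _ _ _

lemma back_succ' (k : ℕ) (x : ℝ × ℝ) : back P (k + 1) x = back P k ((lift P).symm x) := rfl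

lemma back_add (j k : ℕ) (x : ℝ × ℝ) : back P (j + k) x = back P j (back P k x) :=
  Function.iterate_add_apply _ _ _ _

lemma back_succ_lift (k : ℕ) (x : ℝ × ℝ) : back P (k + 1) (lift P x) = back P k x := by
  rw [back_succ', Homeomorph.symm_apply_apply]

lemma lift_back_succ (k : ℕ) (x : ℝ × ℝ) : lift P (back P (k + 1) x) = back P k x := by
  rw [back_succ, Homeomorph.apply_symm_apply]

lemma continuous_back (k : ℕ) : Continuous (back P k) := (lift P).symm.continuous.iterate k

@[simp] lemma coordU_back (k : ℕ) (x : ℝ × ℝ) : coordU (back P k x) = mu ^ k * coordU x := by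
  induction k with
  | zero => simp
  | succ k ih => rw [back_succ, coordU_lift_symm, ih]; ring

lemma coordS_back_le {x y : ℝ × ℝ} (hu : coordU x = coordU y) (hs : coordS x ≤ coordS y) (k : ℕ) :
    coordS (back P k x) ≤ coordS (back P k y) := by
  induction k with
  | zero => exact hs
  | succ k ih =>
    rw [back_succ, back_succ]
    exact coordS_lift_symm_le P (by simp [hu]) ih

lemma back_neg (k : ℕ) (x : ℝ × ℝ) : back P k (-x) = -back P k x := by
  induction k with
  | zero => rfl
  | succ k ih => rw [back_succ, back_succ, ih, lift_symm_neg]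

lemma back_add_ivec (k : ℕ) (x : ℝ × ℝ) (m : ℤ × ℤ) :
    ∃ m' : ℤ × ℤ, back P k (x + ivec m) = back P k x + ivec m' := by
  induction k with
  | zero => exact ⟨m, rfl⟩
  | succ k ih =>
    obtain ⟨m', h⟩ := ih
    rw [back_succ, back_succ, h, lift_symm_add_ivec, linA_symm_ivec]
    exact ⟨_, rfl⟩

/-- The points of the plane whose backward orbit under the lift converges to the origin. -/
def basinZero : Set (ℝ × ℝ) := {x | Tendsto (fun k => back P k x) atTop (𝓝 0)}

/-- The preimage in the plane of the basin of repulsion of the source `0` of the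
derived-from-Anosov map. -/
def basin : Set (ℝ × ℝ) := {x | ∃ m : ℤ × ℤ, x - ivec m ∈ basinZero P}

lemma basinZero_subset_basin : basinZero P ⊆ basin P := fun x hx => ⟨0, by simpa using hx⟩

lemma mem_basinZero_iff_back (j : ℕ) {x : ℝ × ℝ} : back P j x ∈ basinZero P ↔ x ∈ basinZero P := by
  simp only [basinZero, mem_ofPred_eq, ← back_add]
  exact tendsto_add_atTop_iff_nat (f := fun k => back P k x) j

lemma neg_mem_basinZero {x : ℝ × ℝ} (hx : x ∈ basinZero P) : -x ∈ basinZero P := by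
  have : Tendsto (fun k => -back P k x) atTop (𝓝 (-0)) := Tendsto.neg hx
  simpa only [basinZero, mem_ofPred_eq, back_neg, neg_zero] using this

lemma mem_basin_add_ivec {x : ℝ × ℝ} (m : ℤ × ℤ) : x + ivec m ∈ basin P ↔ x ∈ basin P := by
  constructor
  · rintro ⟨n, hn⟩
    refine ⟨n - m, ?_⟩
    rwa [ivec_sub, ← sub_add, sub_add_eq_add_sub]
  · rintro ⟨n, hn⟩
    refine ⟨n + m, ?_⟩
    rwa [ivec_add, add_sub_add_right_eq_sub]

lemma neg_mem_basin {x : ℝ × ℝ} : -x ∈ basin P ↔ x ∈ basin P := by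
  have key : ∀ y, y ∈ basin P → -y ∈ basin P := by
    rintro y ⟨n, hn⟩
    refine ⟨-n, ?_⟩
    have := neg_mem_basinZero P hn
    rwa [ivec_neg, sub_neg_eq_add, neg_add_eq_sub, ← neg_sub]
  exact ⟨fun h => by simpa using key _ h, key x⟩

lemma lift_symm_mem_basin {x : ℝ × ℝ} : (lift P).symm x ∈ basin P ↔ x ∈ basin P := by
  constructor
  · rintro ⟨m, hm⟩
    refine ⟨(2 * m.1 + m.2, m.1 + m.2), ?_⟩
    rw [← linA_ivec, sub_eq_add_neg, ← linA_neg, ← ivec_neg]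
    have h : lift P ((lift P).symm x + ivec (-m)) = x + linA (ivec (-m)) := by
      rw [lift_add_ivec, Homeomorph.apply_symm_apply]
    rw [← h, ← mem_basinZero_iff_back P 1, back_succ_lift, back_zero, ivec_neg, ← sub_eq_add_neg]
    exact hm
  · rintro ⟨m, hm⟩
    refine ⟨(m.1 - m.2, 2 * m.2 - m.1), ?_⟩
    have h : (lift P).symm ((x - ivec m) + ivec m) = (lift P).symm (x - ivec m) + _ :=
      lift_symm_add_ivec P _ m
    rw [sub_add_cancel] at h
    rw [h, linA_symm_ivec, add_sub_cancel_right]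
    exact (mem_basinZero_iff_back P 1).2 hm

lemma lift_mem_basin {x : ℝ × ℝ} : lift P x ∈ basin P ↔ x ∈ basin P := by
  rw [← lift_symm_mem_basin, Homeomorph.symm_apply_apply]

lemma tendsto_mu_pow_mul (c : ℝ) : Tendsto (fun k : ℕ => mu ^ k * c) atTop (𝓝 0) := by
  simpa using (tendsto_pow_atTop_nhds_zero_of_lt_one mu_pos.le mu_lt_one).mul_const c

lemma tendsto_back_of_coordS {x : ℝ × ℝ} {s : ℝ}
    (h : Tendsto (fun k => coordS (back P k x)) atTop (𝓝 s)) :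
    Tendsto (fun k => back P k x) atTop (𝓝 (pt 0 s)) := by
  have h1 : Tendsto (fun k => (coordU (back P k x), coordS (back P k x))) atTop (𝓝 (0, s)) := by
    refine Tendsto.prodMk_nhds ?_ h
    simpa only [coordU_back] using tendsto_mu_pow_mul (coordU x)
  simpa only [Function.comp_def, pt_coord] using (continuous_pt.tendsto (0, s)).comp h1

lemma mem_basinZero_of_coordS {x : ℝ × ℝ}
    (h : Tendsto (fun k => coordS (back P k x)) atTop (𝓝 0)) : x ∈ basinZero P := by
  have := tendsto_back_of_coordS P h
  rwa [pt_zero_zero] at this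

lemma lift_symm_axis {v : ℝ} (hv : |v| < P.r₀) : (lift P).symm (pt v 0) = pt (mu * v) 0 := by
  have h0 : linA (pt (mu * v) 0) = pt v 0 := ext_coord (by simp [lam_mul_mu_mul]) (by simp)
  rw [Homeomorph.symm_apply_eq, lift_apply, h0, flow_of_field_eq_zero]
  rw [field_eq_bumpField_of_lt P]
  · simp [bumpField]
  · simpa using sq_lt_sq' (by linarith [(abs_lt.1 hv).1]) (abs_lt.1 hv).2

lemma axis_mem_basinZero {v : ℝ} (hv : |v| < P.r₀) : pt v 0 ∈ basinZero P := by
  have h : ∀ k, back P k (pt v 0) = pt (mu ^ k * v) 0 := by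
    intro k
    induction k with
    | zero => simp
    | succ k ih =>
      rw [back_succ, ih, lift_symm_axis]
      · congr 1; ring
      · rw [abs_mul, abs_of_pos (pow_pos mu_pos k)]
        exact lt_of_le_of_lt (mul_le_of_le_one_left (abs_nonneg _)
          (pow_le_one₀ mu_pos.le mu_lt_one.le)) hv
  exact mem_basinZero_of_coordS P (by simp [h])

/-- A point above the axis of the ball that the lift does not move closer to the axis lies in the
basin, unless its height is that of the fixed point: the rectangle that it spans with
the origin is mapped into itself by the inverse of the lift, which decreases heights there. -/
lemma mem_basinZero_or_fixed {x : ℝ × ℝ} (h : field P (linA x) = bumpField P (linA x))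
    (hpos : 0 < coordS x) (hle : coordS x ≤ coordS (lift P x)) :
    x ∈ basinZero P ∨
      (coordS x < P.r₀ ∧ lift P (pt 0 (coordS x)) = pt 0 (coordS x)) := by
  obtain ⟨E, hE, hk⟩ := coordS_lift_eq P h
  set a := coordS x with ha
  set u := coordU x with hu
  have hμ := mu_pos
  have hG : 1 ≤ mu * Real.exp (E P.τ) := by
    rw [hk] at hle
    exact le_of_mul_le_mul_right (by linarith) hpos
  have hball : (lam * u) ^ 2 + a ^ 2 < P.r₀ ^ 2 := by
    have h1 : field P (linA x) ≠ 0 := by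
      intro h0
      rw [lift_apply, flow_of_field_eq_zero P h0, coordS_linA] at hle
      nlinarith [mu_lt_one]
    have h2 := field_flow_ne_zero P h1 P.τ
    rw [field_flow_eq_bumpField P h, ← lift_apply] at h2
    have h3 := lt_of_not_ge fun h' => h2 (bumpField_eq_zero P h')
    rw [Real.sqrt_lt' P.r₀_pos, coordU_lift] at h3
    nlinarith
  have har : a < P.r₀ := lt_of_pow_lt_pow_left₀ 2 P.r₀_pos.le (by nlinarith [sq_nonneg (lam * u)])
  have hur : |u| < P.r₀ := by
    refine abs_lt_of_sq_lt_sq ?_ P.r₀_pos.le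
    have h1 : 1 ≤ lam ^ 2 := one_le_pow₀ one_lt_lam.le
    nlinarith [mul_nonneg (sub_nonneg.2 h1) (sq_nonneg u), sq_nonneg a]
  have hgrow : ∀ v s, |v| ≤ |u| → 0 ≤ s → s ≤ a → s ≤ coordS (lift P (pt v s)) := by
    intro v s hv hs hsa
    have hf : field P (linA (pt v s)) = bumpField P (linA (pt v s)) := by
      refine field_eq_bumpField_of_lt P (lt_of_le_of_lt ?_ hball)
      rw [coordU_linA, coordS_linA, coordU_pt, coordS_pt, mul_pow, mul_pow, mul_pow]
      refine add_le_add (mul_le_mul_of_nonneg_left (sq_le_sq.2 hv) (sq_nonneg _)) ?_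
      have h1 : mu ^ 2 ≤ 1 := pow_le_one₀ hμ.le mu_lt_one.le
      nlinarith [sq_nonneg s]
    obtain ⟨G, hG1, hG2⟩ := coordS_lift_eq P hf
    simp only [coordU_pt, coordS_pt] at hG1 hG2
    have hcmp : E P.τ ≤ G P.τ := by
      refine hG1.le_of_abs_le hE ?_ ?_ (tau_pos P).le
      · rw [abs_mul, abs_mul]; exact mul_le_mul_of_nonneg_left hv (abs_nonneg _)
      · rw [abs_mul, abs_mul, abs_of_nonneg hs, abs_of_pos hpos]
        exact mul_le_mul_of_nonneg_left hsa (abs_nonneg _)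
    rw [hG2]
    have h1 : 1 ≤ mu * Real.exp (G P.τ) :=
      hG.trans (mul_le_mul_of_nonneg_left (Real.exp_le_exp.2 hcmp) hμ.le)
    nlinarith
  have hstep : ∀ y, |coordU y| ≤ |u| → 0 ≤ coordS y → coordS y ≤ a →
      0 ≤ coordS ((lift P).symm y) ∧ coordS ((lift P).symm y) ≤ coordS y := by
    intro y hy h0 hya
    constructor
    · have h1 := coordS_lift_symm_le P (x := pt (coordU y) 0) (y := y) (by simp) (by simpa using h0)
      rwa [lift_symm_axis P (hy.trans_lt hur), coordS_pt] at h1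
    · have hv : |mu * coordU y| ≤ |u| := by
        rw [abs_mul, abs_of_pos hμ]
        exact (mul_le_of_le_one_left (abs_nonneg _) mu_lt_one.le).trans hy
      have h1 := coordS_lift_symm_le P (x := y) (y := lift P (pt (mu * coordU y) (coordS y)))
        (by simp [lam_mul_mu_mul]) (hgrow _ _ hv h0 hya)
      rwa [Homeomorph.symm_apply_apply, coordS_pt] at h1
  have hback : ∀ k, |coordU (back P k x)| ≤ |u| ∧ 0 ≤ coordS (back P k x) ∧
      coordS (back P k x) ≤ a := by
    intro k
    induction k with
    | zero => exact ⟨le_rfl, hpos.le, le_rfl⟩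
    | succ k ih =>
      obtain ⟨h1, h2, h3⟩ := ih
      obtain ⟨h4, h5⟩ := hstep _ h1 h2 h3
      rw [back_succ]
      refine ⟨?_, h4, h5.trans h3⟩
      rw [coordU_lift_symm, abs_mul, abs_of_pos hμ]
      exact (mul_le_of_le_one_left (abs_nonneg _) mu_lt_one.le).trans h1
  have hanti : Antitone fun k => coordS (back P k x) := antitone_nat_of_succ_le fun k => by
    rw [back_succ]
    exact (hstep _ (hback k).1 (hback k).2.1 (hback k).2.2).2
  have hlim := tendsto_atTop_ciInf hanti ⟨0, by rintro _ ⟨k, rfl⟩; exact (hback k).2.1⟩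
  set s := ⨅ k, coordS (back P k x)
  have hs0 : 0 ≤ s := ge_of_tendsto' hlim fun k => (hback k).2.1
  have hsa : s ≤ a := le_of_tendsto' hlim fun k => (hback k).2.2
  have hconv := tendsto_back_of_coordS P hlim
  have hfix : lift P (pt 0 s) = pt 0 s := by
    rw [eq_comm, ← Homeomorph.symm_apply_eq]
    refine tendsto_nhds_unique ?_ ((tendsto_add_atTop_iff_nat 1).2 hconv)
    simp only [back_succ]
    exact ((lift P).symm.continuous.tendsto _).comp hconv
  rcases hs0.eq_or_lt with h0 | h0
  · left
    rw [← h0] at hlim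
    exact mem_basinZero_of_coordS P hlim
  · right
    refine ⟨har, ?_⟩
    -- the growth factor is `lam` at the limit height `s`, so it is at most `lam` at `a ≥ s`
    have hf : ∀ c, 0 < c → c ≤ a → field P (linA (pt 0 c)) = bumpField P (linA (pt 0 c)) := by
      intro c hc hca
      refine field_eq_bumpField_of_lt P (lt_of_le_of_lt ?_ hball)
      rw [coordU_linA, coordS_linA, coordU_pt, coordS_pt, mul_pow mu]
      have h1 : mu ^ 2 ≤ 1 := pow_le_one₀ hμ.le mu_lt_one.le
      nlinarith [sq_nonneg (lam * u), sq_nonneg c]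
    obtain ⟨G, hG1, hG2⟩ := coordS_lift_eq P (hf s h0 hsa)
    obtain ⟨K, hK1, hK2⟩ := coordS_lift_eq P (hf a hpos le_rfl)
    simp only [coordU_pt, coordS_pt] at hG1 hG2 hK1 hK2
    rw [hfix, coordS_pt] at hG2
    have hG3 : mu * Real.exp (G P.τ) = 1 := mul_right_cancel₀ h0.ne' (by linarith)
    have hcmp : K P.τ ≤ G P.τ := by
      refine hG1.le_of_abs_le hK1 le_rfl ?_ (tau_pos P).le
      rw [abs_mul, abs_mul, abs_of_pos h0, abs_of_pos hpos]
      exact mul_le_mul_of_nonneg_left hsa (abs_nonneg _)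
    have hK3 : mu * Real.exp (K P.τ) ≤ 1 :=
      hG3 ▸ mul_le_mul_of_nonneg_left (Real.exp_le_exp.2 hcmp) hμ.le
    have hge := hgrow 0 a (by simp) hpos.le le_rfl
    refine ext_coord (by simp) ?_
    rw [coordS_pt]
    refine le_antisymm ?_ hge
    rw [hK2]
    exact mul_le_of_le_one_left hpos.le hK3

/-! ### Contraction of stable segments outside the basin -/

lemma contraction_of_pos {x z : ℝ × ℝ} (hu : coordU x = coordU z) (hs : coordS x < coordS z)
    (hpos : 0 < coordS x) (hx : field P (linA x) = bumpField P (linA x))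
    (hz : field P (linA z) = bumpField P (linA z)) (hxb : x ∉ basinZero P) (hzb : z ∉ basinZero P) :
    coordS (lift P z) - coordS (lift P x) < coordS z - coordS x := by
  rcases lt_or_ge (coordS (lift P x)) (coordS x) with hlt | hge
  · obtain ⟨E, hE, hEx⟩ := coordS_lift_eq P hx
    obtain ⟨G, hG, hGz⟩ := coordS_lift_eq P hz
    have hcmp : G P.τ ≤ E P.τ := by
      refine hE.le_of_abs_le hG (by rw [hu]) ?_ (tau_pos P).le
      rw [abs_mul, abs_mul, abs_of_pos hpos, abs_of_pos (hpos.trans hs)]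
      exact mul_le_mul_of_nonneg_left hs.le (abs_nonneg _)
    have h1 : mu * Real.exp (G P.τ) ≤ mu * Real.exp (E P.τ) :=
      mul_le_mul_of_nonneg_left (Real.exp_le_exp.2 hcmp) mu_pos.le
    have h2 : mu * Real.exp (E P.τ) < 1 := by
      rw [hEx] at hlt
      exact lt_of_mul_lt_mul_right (by linarith) hpos.le
    rw [hEx, hGz]
    nlinarith
  · obtain ⟨-, hfx⟩ := (mem_basinZero_or_fixed P hx hpos hge).resolve_left hxb
    have hlt : coordS (lift P z) < coordS z := by
      by_contra h
      obtain ⟨hr, hfz⟩ :=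
        (mem_basinZero_or_fixed P hz (hpos.trans hs) (not_lt.1 h)).resolve_left hzb
      exact hs.ne (eq_of_fixed P hpos hs.le hr hfx hfz)
    linarith

lemma contraction_of_same_centre_zero {x z : ℝ × ℝ} (hu : coordU x = coordU z)
    (hs : coordS x < coordS z) (hx : field P (linA x) = bumpField P (linA x))
    (hz : field P (linA z) = bumpField P (linA z))
    (hseg : ∀ s ∈ Icc (coordS x) (coordS z), pt (coordU x) s ∉ basinZero P) :
    coordS (lift P z) - coordS (lift P x) < coordS z - coordS x := by
  have hxb : x ∉ basinZero P := by simpa only [pt_coord] using hseg _ ⟨le_rfl, hs.le⟩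
  have hzb : z ∉ basinZero P := by
    have := hseg _ ⟨hs.le, le_rfl⟩
    rwa [hu, pt_coord] at this
  by_cases hr : |lam * coordU x| < P.r₀
  · have hux : |coordU x| < P.r₀ := by
      rw [abs_mul, abs_of_pos lam_pos] at hr
      exact lt_of_le_of_lt (le_mul_of_one_le_left (abs_nonneg _) one_lt_lam.le) hr
    have h0 : (0 : ℝ) ∉ Icc (coordS x) (coordS z) := fun h => hseg 0 h (axis_mem_basinZero P hux)
    rcases lt_or_ge 0 (coordS x) with hpos | hneg
    · exact contraction_of_pos P hu hs hpos hx hz hxb hzb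
    · have hz0 : coordS z < 0 := not_le.1 fun h => h0 ⟨hneg, h⟩
      have hn : ∀ y, field P (linA y) = bumpField P (linA y) →
          field P (linA (-y)) = bumpField P (linA (-y)) := fun y hy => by
        rw [linA_neg, field_neg, bumpField_neg, hy]
      have := contraction_of_pos P (x := -z) (z := -x) (by simp [hu]) (by simpa using hs)
        (by simpa using hz0) (hn z hz) (hn x hx)
        (fun h => hzb (by simpa using neg_mem_basinZero P h))
        (fun h => hxb (by simpa using neg_mem_basinZero P h))
      simp only [lift_neg, coordS_neg] at this
      linarith
  · have hfar : ∀ y, coordU y = coordU x → field P (linA y) = bumpField P (linA y) →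
        coordS (lift P y) = mu * coordS y := by
      intro y hy h
      rw [lift_apply, flow_of_field_eq_zero, coordS_linA]
      rw [h, bumpField_eq_zero]
      refine (not_lt.1 hr).trans (Real.abs_le_sqrt ?_)
      rw [coordU_linA, hy]
      exact le_add_of_nonneg_right (sq_nonneg _)
    rw [hfar x rfl hx, hfar z hu.symm hz]
    nlinarith [mu_lt_one]

lemma field_sub_ivec (y : ℝ × ℝ) (m : ℤ × ℤ) : field P (y - ivec m) = field P y := by
  have := field_add_int P (y - ivec m) m.1 m.2
  rw [← this]
  exact congrArg _ (sub_add_cancel y (ivec m))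

lemma contraction_of_same_centre {x z : ℝ × ℝ} (m : ℤ × ℤ) (hu : coordU x = coordU z)
    (hs : coordS x < coordS z) (hx : field P (linA x) = bumpField P (linA x - ivec m))
    (hz : field P (linA z) = bumpField P (linA z - ivec m))
    (hseg : ∀ s ∈ Icc (coordS x) (coordS z), pt (coordU x) s ∉ basin P) :
    coordS (lift P z) - coordS (lift P x) < coordS z - coordS x := by
  obtain ⟨n, hn⟩ : ∃ n, linA (ivec n) = ivec m :=
    ⟨_, by rw [← linA_symm_ivec, Homeomorph.apply_symm_apply]⟩
  have hlin : ∀ y, linA (y + ivec (-n)) = linA y - ivec m := fun y => by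
    rw [linA_add, ivec_neg, linA_neg, hn, sub_eq_add_neg]
  have := contraction_of_same_centre_zero P (x := x + ivec (-n)) (z := z + ivec (-n))
    (by simp [coordU_add, hu]) (by simpa [coordS_add] using hs)
    (by rw [hlin, field_sub_ivec, hx]) (by rw [hlin, field_sub_ivec, hz])
    (fun s hsm hsb => by
      refine hseg (s - coordS (ivec (-n))) ?_ ?_
      · simp only [coordS_add, mem_Icc] at hsm
        exact ⟨by linarith [hsm.1], by linarith [hsm.2]⟩
      · rw [← mem_basin_add_ivec P (-n)]
        refine basinZero_subset_basin P ?_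
        convert hsb using 1
        exact ext_coord (by simp [coordU_add]) (by simp [coordS_add]))
  simpa [lift_add_ivec, coordS_add] using this

/-- Near every point, the field is given by the same summand as at that point. -/
lemma eventually_same_centre (y : ℝ × ℝ) : ∀ᶠ z in 𝓝 y, ∃ m : ℤ × ℤ,
    field P y = bumpField P (y - ivec m) ∧ field P z = bumpField P (z - ivec m) := by
  have hne : ∀ z (m : ℤ × ℤ), bumpField P (z - ivec m) ≠ 0 → field P z = bumpField P (z - ivec m) :=
    fun z m => field_eq_of_ne P m.1 m.2
  by_cases h : ∃ m : ℤ × ℤ, bumpField P (y - ivec m) ≠ 0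
  · obtain ⟨m, hm⟩ := h
    have hc : Continuous fun z => bumpField P (z - ivec m) :=
      (continuous_bumpField P).comp (continuous_id.sub continuous_const)
    filter_upwards [hc.continuousAt.eventually_ne hm] with z hz
    exact ⟨m, hne y m hm, hne z m hz⟩
  · push Not at h
    have hr : ∀ z, field P z = bumpField P (z - ivec (round z.1, round z.2)) := fun z => rfl
    exact Eventually.of_forall fun z => ⟨(round z.1, round z.2),
      by rw [hr y, h, h], hr z⟩

lemma lt_of_eventually_lt_right {g : ℝ → ℝ} (hg : Continuous g) {a b : ℝ} (hab : a < b)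
    (h : ∀ t ∈ Ico a b, ∀ᶠ r in 𝓝[>] t, g r < g t) : g b < g a := by
  have weak : ∀ c ∈ Ico a b, g b ≤ g c := by
    intro c hc
    have hcl : IsClosed ({r | g r ≤ g c} ∩ Icc c b) :=
      (isClosed_le hg continuous_const).inter isClosed_Icc
    refine hcl.Icc_subset_of_forall_mem_nhdsWithin (le_refl (g c)) ?_ ⟨hc.2.le, le_rfl⟩
    rintro t ⟨ht, ht'⟩
    filter_upwards [h t ⟨hc.1.trans ht'.1, ht'.2⟩] with r hr using hr.le.trans ht
  obtain ⟨c, hc1, hc2⟩ := ((h a ⟨le_rfl, hab⟩).and (Ioo_mem_nhdsGT hab)).exists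
  exact (weak c ⟨hc2.1.le, hc2.2⟩).trans_lt hc1

/-- The lift strictly contracts every segment of a stable leaf that misses the basin. -/
lemma contraction {x : ℝ × ℝ} {b : ℝ} (hb : 0 < b)
    (hseg : ∀ t ∈ Icc 0 b, x + t • vs ∉ basin P) :
    coordS (lift P (x + b • vs)) - coordS (lift P x) < b := by
  have hline : Continuous fun t : ℝ => x + t • vs := by fun_prop
  have hg : Continuous fun t : ℝ => coordS (lift P (x + t • vs)) - t :=
    (continuous_coordS.comp ((lift P).continuous.comp hline)).sub continuous_id
  have := lt_of_eventually_lt_right hg hb (fun t ht => by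
    have hev := ((linA.continuous.comp hline).tendsto t).eventually
      (eventually_same_centre P (linA (x + t • vs)))
    filter_upwards [nhdsWithin_le_nhds hev, Ioo_mem_nhdsGT ht.2] with r hr hrt
    obtain ⟨m, h1, h2⟩ := hr
    have := contraction_of_same_centre P (x := x + t • vs) (z := x + r • vs) m
      (by simp [coordU_add, coordU_smul_vs])
      (by simpa [coordS_add, coordS_smul_vs] using hrt.1) h1 h2 (fun s hs hsb => by
        simp only [coordS_add, coordS_smul_vs, mem_Icc] at hs
        refine hseg (s - coordS x) ⟨by linarith [ht.1], by linarith [hrt.2]⟩ ?_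
        convert hsb using 1
        exact ext_coord (by simp [coordU_add, coordU_smul_vs])
          (by simp [coordS_add, coordS_smul_vs]))
    simp only [coordS_add, coordS_smul_vs] at this
    linarith)
  simp only [zero_smul, add_zero, sub_zero] at this
  linarith

/-! ### The source -/

/-- The eigenvalue of the inverse of the lift at the origin in the stable direction of the linear
map. -/
def kap : ℝ := lam * Real.exp (-P.τ)

lemma kap_pos : 0 < kap P := mul_pos lam_pos (Real.exp_pos _)

lemma kap_lt_one : kap P < 1 := by
  rw [kap, Real.exp_neg, ← div_eq_mul_inv, div_lt_one (Real.exp_pos _)]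
  exact lam_lt_exp_tau P

/-- The rate at which the inverse of the lift contracts towards the origin. -/
def rate : ℝ := max mu (kap P)

lemma rate_pos : 0 < rate P := mu_pos.trans_le (le_max_left _ _)

lemma rate_lt_one : rate P < 1 := max_lt mu_lt_one (kap_lt_one P)

/-- The supremum norm in eigencoordinates. -/
def gauge (x : ℝ × ℝ) : ℝ := max |coordU x| |coordS x|

lemma continuous_gauge : Continuous gauge :=
  (continuous_coordU.abs).max continuous_coordS.abs

lemma gauge_nonneg (x : ℝ × ℝ) : 0 ≤ gauge x := (abs_nonneg _).trans (le_max_left _ _)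

@[simp] lemma gauge_zero : gauge 0 = 0 := by simp [gauge]

@[simp] lemma gauge_neg (x : ℝ × ℝ) : gauge (-x) = gauge x := by simp [gauge]

lemma gauge_pos {x : ℝ × ℝ} (hx : x ≠ 0) : 0 < gauge x := by
  refine (gauge_nonneg x).lt_of_ne fun h => hx (ext_coord ?_ ?_)
  · rw [coordU_zero, ← abs_nonpos_iff, h]; exact le_max_left _ _
  · rw [coordS_zero, ← abs_nonpos_iff, h]; exact le_max_right _ _

lemma norm_le_gauge (x : ℝ × ℝ) : ‖x‖ ≤ 2 * gauge x := by
  have h := norm_le_coord x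
  have h1 : |coordU x| ≤ gauge x := le_max_left _ _
  have h2 : |coordS x| ≤ gauge x := le_max_right _ _
  linarith

/-- Near the origin, the inverse of the lift is linear. -/
lemma lift_symm_of_gauge_lt {x : ℝ × ℝ} (hx : gauge x < P.r₀ / 4) :
    (lift P).symm x = pt (mu * coordU x) (kap P * coordS x) := by
  obtain ⟨hu, hs⟩ := max_lt_iff.1 hx
  have hr := P.r₀_pos
  have hu2 : coordU x ^ 2 ≤ (P.r₀ / 4) ^ 2 := 
    sq_le_sq' (by linarith [(abs_lt.1 hu).1]) (abs_lt.1 hu).2.le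
  have hs2 : coordS x ^ 2 ≤ (P.r₀ / 4) ^ 2 := 
    sq_le_sq' (by linarith [(abs_lt.1 hs).1]) (abs_lt.1 hs).2.le
  obtain ⟨E, hE, hE2⟩ := exists_growth P (x := x)
    (field_eq_bumpField_of_lt P (by nlinarith))
  have hone : ∀ t ≤ 0, HasDerivAt E 1 t := by
    intro t ht
    have h1 : Real.exp (E t) ^ 2 ≤ 1 := by
      refine pow_le_one₀ (Real.exp_pos _).le (Real.exp_le_one_iff.2 ?_)
      rw [← hE.1]; exact hE.monotone ht
    have h2 := hE.2 t
    rwa [P.δ_eq_one] at h2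
    refine Real.sqrt_le_iff.2 ⟨by positivity, ?_⟩
    rw [mul_pow]
    nlinarith [sq_nonneg (coordS x)]
  have hEτ : E (-P.τ) = -P.τ := by
    have := constant_of_has_deriv_right_zero (f := fun t => E t - t) (a := -P.τ) (b := 0)
      (hE.differentiable.continuous.sub continuous_id).continuousOn
      (fun t ht => by
        have h : HasDerivAt (fun t => E t - t) (1 - 1) t := (hone t ht.2.le).sub (hasDerivAt_id t)
        rw [sub_self] at h
        exact h.hasDerivWithinAt) 0 ⟨by linarith [tau_pos P], le_rfl⟩
    simp only [hE.1] at this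
    linarith
  refine ext_coord (by simp) ?_
  rw [lift_symm_apply, coordS_linA_symm, hE2, hEτ, coordS_pt, kap]
  ring

lemma gauge_lift_symm_le {x : ℝ × ℝ} (hx : gauge x < P.r₀ / 4) :
    gauge ((lift P).symm x) ≤ rate P * gauge x := by
  rw [lift_symm_of_gauge_lt P hx, gauge, coordU_pt, coordS_pt, abs_mul, abs_mul, abs_of_pos mu_pos,
    abs_of_pos (kap_pos P)]
  refine max_le ?_ ?_
  · exact mul_le_mul (le_max_left _ _) (le_max_left _ _) (abs_nonneg _) (rate_pos P).le
  · exact mul_le_mul (le_max_right _ _) (le_max_right _ _) (abs_nonneg _) (rate_pos P).le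

lemma gauge_back_le {x : ℝ × ℝ} (hx : gauge x < P.r₀ / 4) (k : ℕ) :
    gauge (back P k x) ≤ rate P ^ k * gauge x := by
  induction k with
  | zero => simp
  | succ k ih =>
    have h1 : gauge (back P k x) < P.r₀ / 4 := by
      refine (ih.trans (mul_le_of_le_one_left (gauge_nonneg x) ?_)).trans_lt hx
      exact pow_le_one₀ (rate_pos P).le (rate_lt_one P).le
    rw [back_succ, pow_succ', mul_assoc]
    exact (gauge_lift_symm_le P h1).trans (mul_le_mul_of_nonneg_left ih (rate_pos P).le)

lemma mem_basinZero_of_gauge_lt {x : ℝ × ℝ} (hx : gauge x < P.r₀ / 4) : x ∈ basinZero P := by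
  have h1 : Tendsto (fun k => 2 * (rate P ^ k * gauge x)) atTop (𝓝 0) := by
    simpa using ((tendsto_pow_atTop_nhds_zero_of_lt_one (rate_pos P).le
      (rate_lt_one P)).mul_const (gauge x)).const_mul 2
  exact squeeze_zero_norm (fun k => (norm_le_gauge _).trans
    (mul_le_mul_of_nonneg_left (gauge_back_le P hx k) zero_le_two)) h1

lemma exists_gauge_back_lt {x : ℝ × ℝ} (hx : x ∈ basinZero P) {ε : ℝ} (hε : 0 < ε) :
    ∃ k, gauge (back P k x) < ε := by
  have h : Tendsto (fun k => gauge (back P k x)) atTop (𝓝 (gauge 0)) :=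
    (continuous_gauge.tendsto 0).comp hx
  rw [gauge_zero] at h
  exact (h.eventually (gt_mem_nhds hε)).exists

lemma isOpen_basinZero : IsOpen (basinZero P) := by
  refine isOpen_iff_mem_nhds.2 fun x hx => ?_
  obtain ⟨k, hk⟩ := exists_gauge_back_lt P hx (ε := P.r₀ / 4) (by linarith [P.r₀_pos])
  have ho : IsOpen {y | gauge (back P k y) < P.r₀ / 4} :=
    isOpen_lt (continuous_gauge.comp (continuous_back P k)) continuous_const
  filter_upwards [ho.mem_nhds hk] with y hy
  exact (mem_basinZero_iff_back P k).1 (mem_basinZero_of_gauge_lt P hy)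

lemma isOpen_basin : IsOpen (basin P) := by
  have : basin P = ⋃ m, (fun x => x - ivec m) ⁻¹' basinZero P := by
    ext x; simp [basin]
  rw [this]
  exact isOpen_iUnion fun m => (isOpen_basinZero P).preimage (continuous_id.sub continuous_const)

/-! ### Backward expansion of stable segments outside the basin -/

lemma add_smul_vs_eq {x y : ℝ × ℝ} (h : coordU x = coordU y) :
    y = x + (coordS y - coordS x) • vs :=
  ext_coord (by simp [coordU_add, coordU_smul_vs, h]) (by simp [coordS_add, coordS_smul_vs])

/-- Backward images of a stable segment that misses the basin are segments that miss the
basin, and they get longer. -/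
lemma back_segment {x : ℝ × ℝ} {b : ℝ} (hb : 0 < b)
    (hseg : ∀ t ∈ Icc 0 b, x + t • vs ∉ basin P) : ∃ c, b < c ∧
      (lift P).symm (x + b • vs) = (lift P).symm x + c • vs ∧
      ∀ t ∈ Icc 0 c, (lift P).symm x + t • vs ∉ basin P := by
  set z := x + b • vs with hz
  have huz : coordU x = coordU z := by simp [hz, coordU_add, coordU_smul_vs]
  have hsz : coordS z = coordS x + b := by simp [hz, coordS_add, coordS_smul_vs]
  set c := coordS ((lift P).symm z) - coordS ((lift P).symm x) with hc
  have hzc : (lift P).symm z = (lift P).symm x + c • vs := add_smul_vs_eq (by simp [huz])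
  have hc0 : 0 < c := sub_pos.2 (coordS_lift_symm_lt P huz (by linarith))
  have hseg' : ∀ t ∈ Icc 0 c, (lift P).symm x + t • vs ∉ basin P := by
    intro t ht hmem
    rw [← lift_mem_basin] at hmem
    set y := lift P ((lift P).symm x + t • vs) with hy
    have hlow : coordS x ≤ coordS y := by
      by_contra h
      have := coordS_lift_symm_lt P (x := y) (y := x)
        (by simp [hy, coordU_add, coordU_smul_vs, lam_mul_mu_mul]) (not_le.1 h)
      rw [hy, Homeomorph.symm_apply_apply, coordS_add, coordS_smul_vs] at this
      linarith [ht.1]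
    have hhigh : coordS y ≤ coordS z := by
      by_contra h
      have := coordS_lift_symm_lt P (x := z) (y := y)
        (by simp [hy, coordU_add, coordU_smul_vs, lam_mul_mu_mul, huz]) (not_le.1 h)
      rw [hy, Homeomorph.symm_apply_apply, coordS_add, coordS_smul_vs] at this
      linarith [ht.2]
    refine hseg (coordS y - coordS x) ⟨by linarith, by linarith⟩ ?_
    rwa [← add_smul_vs_eq (by simp [hy, coordU_add, coordU_smul_vs, lam_mul_mu_mul])]
  refine ⟨c, ?_, hzc, hseg'⟩
  have := contraction P hc0 hseg'
  rw [← hzc, Homeomorph.apply_symm_apply, Homeomorph.apply_symm_apply, hsz] at this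
  linarith

lemma exists_ivec_mem_unitSquare (x : ℝ × ℝ) :
    ∃ m : ℤ × ℤ, x + ivec m ∈ Icc (0 : ℝ × ℝ) 1 := by
  refine ⟨(-⌊x.1⌋, -⌊x.2⌋), ⟨?_, ?_⟩, ⟨?_, ?_⟩⟩
  · have := Int.floor_le x.1; simpa [ivec] using this
  · have := Int.floor_le x.2; simpa [ivec] using this
  · have := Int.lt_floor_add_one x.1; simp [ivec]; linarith
  · have := Int.lt_floor_add_one x.2; simp [ivec]; linarith

/-- A stable segment that misses the basin has unbounded backward images. Otherwise a limit
of translates of them would be a segment that misses the basin and is not contracted. -/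
lemma unbounded_back_segment {x : ℝ × ℝ} {b : ℝ} (hb : 0 < b)
    (hseg : ∀ t ∈ Icc 0 b, x + t • vs ∉ basin P) (L : ℝ) :
    ∃ k, L < coordS (back P k (x + b • vs)) - coordS (back P k x) := by
  by_contra! hL
  set ℓ : ℕ → ℝ := fun k => coordS (back P k (x + b • vs)) - coordS (back P k x) with hℓ
  have hind : ∀ k, 0 < ℓ k ∧ back P k (x + b • vs) = back P k x + ℓ k • vs ∧
      ∀ t ∈ Icc 0 (ℓ k), back P k x + t • vs ∉ basin P := by
    intro k
    induction k with
    | zero =>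
      have : ℓ 0 = b := by simp [hℓ, coordS_add, coordS_smul_vs]
      rw [this]
      exact ⟨hb, rfl, hseg⟩
    | succ k ih =>
      obtain ⟨h1, h2, h3⟩ := ih
      obtain ⟨c, hc1, hc2, hc3⟩ := back_segment P h1 h3
      rw [← h2, ← back_succ, ← back_succ] at hc2
      have hcℓ : ℓ (k + 1) = c := by
        simp only [hℓ]
        rw [hc2, coordS_add, coordS_smul_vs, add_sub_cancel_left]
      rw [hcℓ, hc2]
      exact ⟨h1.trans hc1, rfl, by rwa [back_succ]⟩
  have hmono : Monotone ℓ := by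
    refine monotone_nat_of_le_succ fun k => ?_
    obtain ⟨h1, h2, h3⟩ := hind k
    obtain ⟨c, hc1, hc2, -⟩ := back_segment P h1 h3
    rw [← h2, ← back_succ, ← back_succ] at hc2
    have hcℓ : ℓ (k + 1) = c := by
      simp only [hℓ]
      rw [hc2, coordS_add, coordS_smul_vs, add_sub_cancel_left]
    rw [hcℓ]; exact hc1.le
  have hlim := tendsto_atTop_ciSup hmono ⟨L, by rintro _ ⟨k, rfl⟩; exact hL k⟩
  set a := ⨆ k, ℓ k
  have ha : 0 < a := (hind 0).1.trans_le (hmono.ge_of_tendsto hlim 0)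
  choose m hm using fun k => exists_ivec_mem_unitSquare (back P (k + 1) x)
  obtain ⟨y, -, φ, hφ, hy⟩ := (isCompact_Icc (a := (0 : ℝ × ℝ)) (b := 1)).tendsto_subseq hm
  have hlim1 : Tendsto (fun k => ℓ (φ k + 1)) atTop (𝓝 a) :=
    hlim.comp ((tendsto_add_atTop_nat 1).comp hφ.tendsto_atTop)
  have hysub : ∀ t ∈ Icc 0 a, y + t • vs ∉ basin P := by
    intro t ht
    have h1 : Tendsto (fun k => min t (ℓ (φ k + 1))) atTop (𝓝 t) := by
      simpa [min_eq_left ht.2] using (tendsto_const_nhds (x := t)).min hlim1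
    have h2 := hy.add (h1.smul_const vs)
    refine (isOpen_basin P).isClosed_compl.mem_of_tendsto h2 (Eventually.of_forall fun k => ?_)
    have h3 := (hind (φ k + 1)).2.2 (min t (ℓ (φ k + 1)))
      ⟨le_min ht.1 (hind _).1.le, min_le_right _ _⟩
    simp only [Function.comp_apply, mem_compl_iff]
    rwa [add_right_comm, mem_basin_add_ivec]
  have hcon := contraction P ha hysub
  have hc1 : Tendsto (fun k => coordS (lift P (back P (φ k + 1) x + ivec (m (φ k)) +
      ℓ (φ k + 1) • vs)) - coordS (lift P (back P (φ k + 1) x + ivec (m (φ k))))) atTop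
      (𝓝 (coordS (lift P (y + a • vs)) - coordS (lift P y))) := by
    have hc := continuous_coordS.comp (lift P).continuous
    exact ((hc.tendsto _).comp (hy.add (hlim1.smul_const vs))).sub ((hc.tendsto _).comp hy)
  have hc2 : ∀ k, coordS (lift P (back P (φ k + 1) x + ivec (m (φ k)) + ℓ (φ k + 1) • vs)) -
      coordS (lift P (back P (φ k + 1) x + ivec (m (φ k)))) = ℓ (φ k) := by
    intro k
    rw [add_right_comm, ← (hind (φ k + 1)).2.1, lift_add_ivec, lift_add_ivec, lift_back_succ,
      lift_back_succ, coordS_add, coordS_add, add_sub_add_right_eq_sub]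
  simp only [hc2] at hc1
  exact hcon.ne (tendsto_nhds_unique hc1 (hlim.comp hφ.tendsto_atTop))

/-! ### The semiconjugacy with the linear map -/

/-- The difference of the stable coordinates of the lift and of the linear map. -/
def disp (x : ℝ × ℝ) : ℝ := coordS (lift P x) - mu * coordS x

lemma continuous_disp : Continuous (disp P) :=
  (continuous_coordS.comp (lift P).continuous).sub (continuous_const.mul continuous_coordS)

lemma abs_disp_le (x : ℝ × ℝ) : |disp P x| ≤ 2 * P.τ := by
  have h : ∀ t ∈ (univ : Set ℝ), HasDerivWithinAt (fun r => coordS (flow P r (linA x)))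
      (coordS (field P (flow P t (linA x)))) univ t := fun t _ =>
    (hasDerivAt_coordS (hasDerivAt_flow P (linA x) t)).hasDerivWithinAt
  have h2 := convex_univ.norm_image_sub_le_of_norm_hasDerivWithin_le (C := 2) h (fun t _ => by
    refine (abs_coordS_le _).trans ?_
    have : ‖field P (flow P t (linA x))‖ ≤ 1 := norm_bumpField_le P _
    linarith) (mem_univ 0) (mem_univ P.τ)
  rw [flow_zero, sub_zero, coordS_linA, Real.norm_eq_abs, Real.norm_eq_abs,
    abs_of_pos (tau_pos P)] at h2
  exact h2

lemma disp_add_ivec (x : ℝ × ℝ) (m : ℤ × ℤ) : disp P (x + ivec m) = disp P x := by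
  rw [disp, disp, lift_add_ivec, coordS_add, coordS_add, coordS_linA]; ring

lemma summable_disp_bound : Summable fun n : ℕ => mu ^ n * (2 * P.τ) :=
  (summable_geometric_of_lt_one mu_pos.le mu_lt_one).mul_right _

lemma norm_disp_term_le (n : ℕ) (x : ℝ × ℝ) :
    ‖mu ^ n * disp P (back P (n + 1) x)‖ ≤ mu ^ n * (2 * P.τ) := by
  rw [norm_mul, Real.norm_eq_abs, Real.norm_eq_abs, abs_of_pos (pow_pos mu_pos n)]
  exact mul_le_mul_of_nonneg_left (abs_disp_le P _) (pow_pos mu_pos n).le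

/-- The stable coordinate of the semiconjugacy from the lift to the linear map: the solution of
`height (lift x) = mu * height x` at bounded distance from the stable coordinate. -/
def height (x : ℝ × ℝ) : ℝ := coordS x - ∑' n : ℕ, mu ^ n * disp P (back P (n + 1) x)

lemma continuous_height : Continuous (height P) :=
  continuous_coordS.sub (continuous_tsum (fun n => continuous_const.mul
    ((continuous_disp P).comp (continuous_back P (n + 1)))) (summable_disp_bound P)
    (norm_disp_term_le P))

lemma exists_height_bound : ∃ M, ∀ x, |height P x - coordS x| ≤ M := by
  refine ⟨∑' n : ℕ, mu ^ n * (2 * P.τ), fun x => ?_⟩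
  rw [height, sub_sub_cancel_left, abs_neg]
  exact tsum_of_norm_bounded (summable_disp_bound P).hasSum fun n => norm_disp_term_le P n x

lemma height_lift (x : ℝ × ℝ) : height P (lift P x) = mu * height P x := by
  have hs : Summable fun n : ℕ => mu ^ n * disp P (back P (n + 1) (lift P x)) :=
    (summable_disp_bound P).of_norm_bounded fun n => norm_disp_term_le P n _
  rw [height, height, hs.tsum_eq_zero_add, mul_sub, ← tsum_mul_left]
  simp only [back_succ_lift, pow_zero, one_mul, back_zero, pow_succ', mul_assoc]
  rw [disp]
  ring

lemma height_back (k : ℕ) (x : ℝ × ℝ) : mu ^ k * height P (back P k x) = height P x := by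
  induction k with
  | zero => simp
  | succ k ih => rw [← ih, ← lift_back_succ P k, height_lift]; ring

lemma height_add_ivec (x : ℝ × ℝ) (m : ℤ × ℤ) :
    height P (x + ivec m) = height P x + coordS (ivec m) := by
  have h : ∀ n, disp P (back P n (x + ivec m)) = disp P (back P n x) := fun n => by
    obtain ⟨m', hm⟩ := back_add_ivec P n x m
    rw [hm, disp_add_ivec]
  simp only [height, h, coordS_add]
  ring

lemma height_le {x z : ℝ × ℝ} (hu : coordU x = coordU z) (hs : coordS x ≤ coordS z) :
    height P x ≤ height P z := by
  obtain ⟨M, hM⟩ := exists_height_bound P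
  have h1 : ∀ k : ℕ, mu ^ k * (-(2 * M)) ≤ height P z - height P x := by
    intro k
    rw [← height_back P k z, ← height_back P k x, ← mul_sub]
    refine mul_le_mul_of_nonneg_left ?_ (pow_pos mu_pos k).le
    have h2 := abs_le.1 (hM (back P k z))
    have h3 := abs_le.1 (hM (back P k x))
    have h4 := coordS_back_le P hu hs k
    linarith [h2.1, h3.2]
  exact sub_nonneg.1 (le_of_tendsto' (tendsto_mu_pow_mul _) h1)

lemma height_basinZero {x : ℝ × ℝ} (hx : x ∈ basinZero P) : height P x = 0 := by
  have h : Tendsto (fun k : ℕ => mu ^ k * height P (back P k x)) atTop (𝓝 (0 * height P 0)) :=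
    (tendsto_pow_atTop_nhds_zero_of_lt_one mu_pos.le mu_lt_one).mul
      (((continuous_height P).tendsto 0).comp hx)
  simp only [height_back, zero_mul] at h
  exact tendsto_nhds_unique tendsto_const_nhds h

lemma height_sub_ivec_of_basin {x : ℝ × ℝ} {m : ℤ × ℤ} (hx : x - ivec m ∈ basinZero P) :
    height P x = coordS (ivec m) := by
  have := height_add_ivec P (x - ivec m) m
  rwa [sub_add_cancel, height_basinZero P hx, zero_add] at this

/-- The semiconjugacy is injective on stable segments that miss the basin. -/
lemma height_lt {x : ℝ × ℝ} {b : ℝ} (hb : 0 < b)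
    (hseg : ∀ t ∈ Icc 0 b, x + t • vs ∉ basin P) : height P x < height P (x + b • vs) := by
  have hu : coordU x = coordU (x + b • vs) := by simp [coordU_add, coordU_smul_vs]
  refine (height_le P hu (by simp [coordS_add, coordS_smul_vs, hb.le])).lt_of_ne fun heq => ?_
  obtain ⟨M, hM⟩ := exists_height_bound P
  obtain ⟨k, hk⟩ := unbounded_back_segment P hb hseg (2 * M)
  have h1 : height P (back P k x) = height P (back P k (x + b • vs)) := by
    refine mul_left_cancel₀ (pow_pos mu_pos k).ne' ?_
    rw [height_back, height_back, heq]
  have h2 := abs_le.1 (hM (back P k x))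
  have h3 := abs_le.1 (hM (back P k (x + b • vs)))
  linarith [h2.2, h3.1]

lemma exists_height_eq (u h : ℝ) : ∃ x, coordU x = u ∧ height P x = h := by
  obtain ⟨M, hM⟩ := exists_height_bound P
  have hc : Continuous fun s => height P (pt u s) :=
    (continuous_height P).comp (continuous_pt.comp (by fun_prop : Continuous fun s : ℝ => (u, s)))
  obtain ⟨s, hs⟩ : h ∈ range fun s => height P (pt u s) := by
    refine mem_range_of_exists_le_of_exists_ge hc ⟨h - M, ?_⟩ ⟨h + M, ?_⟩
    · have := abs_le.1 (hM (pt u (h - M)))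
      rw [coordS_pt] at this
      linarith [this.2]
    · have := abs_le.1 (hM (pt u (h + M)))
      rw [coordS_pt] at this
      linarith [this.1]
  exact ⟨pt u s, by simp, hs⟩

/-! ### The covering of the sphere by the plane -/

/-- The projection of the plane to the sphere. -/
def cov (x : ℝ × ℝ) : S2 := quo (proj x)

lemma continuous_cov : Continuous cov :=
  isQuotientMap_quo.continuous.comp isOpenQuotientMap_proj.continuous

lemma cov_surjective : Function.Surjective cov := quo_surjective.comp proj_surjective

lemma isOpenMap_quo : IsOpenMap quo := by
  intro U hU
  rw [← isQuotientMap_quo.isOpen_preimage]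
  have : quo ⁻¹' (quo '' U) = U ∪ Neg.neg ⁻¹' U := by
    ext p
    constructor
    · rintro ⟨q, hq, h⟩
      rcases quo_eq_iff.1 h with rfl | rfl
      · exact Or.inl hq
      · exact Or.inr hq
    · rintro (h | h)
      · exact ⟨p, h, rfl⟩
      · exact ⟨-p, h, quo_neg p⟩
  rw [this]
  exact hU.union (hU.preimage continuous_neg)

lemma isOpenMap_cov : IsOpenMap cov := isOpenMap_quo.comp isOpenQuotientMap_proj.isOpenMap

lemma proj_add_ivec (x : ℝ × ℝ) (m : ℤ × ℤ) : proj (x + ivec m) = proj x :=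
  proj_add_int x m.1 m.2

lemma exists_ivec_of_proj_eq {x y : ℝ × ℝ} (h : proj x = proj y) :
    ∃ m : ℤ × ℤ, x = y + ivec m := by
  obtain ⟨m, n, h⟩ := exists_int_of_proj_eq h
  exact ⟨(m, n), h⟩

lemma cov_add_ivec (x : ℝ × ℝ) (m : ℤ × ℤ) : cov (x + ivec m) = cov x := by
  rw [cov, proj_add_ivec, cov]

lemma cov_sub_ivec (x : ℝ × ℝ) (m : ℤ × ℤ) : cov (x - ivec m) = cov x := by
  rw [sub_eq_add_neg, ← ivec_neg, cov_add_ivec]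

lemma exists_ivec_of_cov_eq {x y : ℝ × ℝ} (h : cov x = cov y) :
    ∃ m : ℤ × ℤ, x = y + ivec m ∨ x = -y + ivec m := by
  rcases quo_eq_iff.1 h with h | h
  · obtain ⟨m, hm⟩ := exists_ivec_of_proj_eq h
    exact ⟨m, Or.inl hm⟩
  · rw [← proj_neg] at h
    obtain ⟨m, hm⟩ := exists_ivec_of_proj_eq h
    exact ⟨m, Or.inr hm⟩

lemma fPDA_cov (x : ℝ × ℝ) : fPDA P (cov x) = cov (lift P x) := by
  rw [cov, fPDA_quo, ← proj_lift, cov]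

lemma fPDA_symm_cov (x : ℝ × ℝ) : (fPDA P).symm (cov x) = cov ((lift P).symm x) := by
  rw [Homeomorph.symm_apply_eq, fPDA_cov, Homeomorph.apply_symm_apply]

lemma zpow_semiconj {X Y : Type*} [TopologicalSpace X] [TopologicalSpace Y] {f : X ≃ₜ X}
    {g : Y ≃ₜ Y} {q : X → Y} (h : ∀ x, g (q x) = q (f x)) (n : ℤ) (x : X) :
    (g ^ n) (q x) = q ((f ^ n) x) := by
  have hnat : ∀ (k : ℕ) (x : X), (g ^ k) (q x) = q ((f ^ k) x) := by
    intro k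
    induction k with
    | zero => exact fun _ => rfl
    | succ k ih =>
      intro x
      rw [pow_succ, pow_succ, Homeomorph.mul_apply, Homeomorph.mul_apply, h, ih]
  obtain ⟨k, rfl | rfl⟩ := n.eq_nat_or_neg
  · exact hnat k x
  · rw [zpow_neg, zpow_neg, zpow_natCast, zpow_natCast]
    refine (Homeomorph.symm_apply_eq _).2 ?_
    rw [hnat]
    exact congrArg q ((f ^ k).apply_symm_apply x).symm

lemma lift_zpow_natCast (n : ℕ) (x : ℝ × ℝ) : (lift P ^ (n : ℤ)) x = (lift P)^[n] x := by
  rw [zpow_natCast]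
  induction n generalizing x with
  | zero => rfl
  | succ n ih => rw [pow_succ, Homeomorph.mul_apply, ih, Function.iterate_succ_apply]

lemma lift_zpow_neg_natCast (n : ℕ) (x : ℝ × ℝ) : (lift P ^ (-(n : ℤ))) x = back P n x := by
  rw [zpow_neg, zpow_natCast, ← inv_pow]
  induction n generalizing x with
  | zero => rfl
  | succ n ih => rw [pow_succ, Homeomorph.mul_apply, ih]; rfl

lemma fPDA_pow_cov (n : ℕ) (x : ℝ × ℝ) : (fPDA P ^ n) (cov x) = cov ((lift P)^[n] x) := by
  rw [← lift_zpow_natCast, ← zpow_semiconj (fPDA_cov P), zpow_natCast]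

lemma fPDA_zpow_neg_cov (n : ℕ) (x : ℝ × ℝ) :
    (fPDA P ^ (-(n : ℤ))) (cov x) = cov (back P n x) := by
  rw [← lift_zpow_neg_natCast, zpow_semiconj (fPDA_cov P)]

/-- The complement in the sphere of the image of the basin of the source. -/
def attractor : Set S2 := (cov '' basin P)ᶜ

lemma cov_mem_attractor {x : ℝ × ℝ} : cov x ∈ attractor P ↔ x ∉ basin P := by
  refine not_congr ⟨?_, fun h => mem_image_of_mem _ h⟩
  rintro ⟨y, hy, h⟩
  obtain ⟨m, rfl | rfl⟩ := exists_ivec_of_cov_eq h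
  · exact (mem_basin_add_ivec P m).1 hy
  · exact (neg_mem_basin P).1 ((mem_basin_add_ivec P m).1 hy)

lemma isClosed_attractor : IsClosed (attractor P) :=
  (isOpenMap_cov _ (isOpen_basin P)).isClosed_compl

lemma fPDA_image_attractor : fPDA P '' attractor P = attractor P := by
  rw [Homeomorph.image_eq_preimage_symm]
  ext y
  obtain ⟨x, rfl⟩ := cov_surjective y
  rw [mem_preimage, fPDA_symm_cov, cov_mem_attractor, cov_mem_attractor, lift_symm_mem_basin]

end PseudoDA

/-! ### Non-wandering sets -/

lemma isClosed_nonwanderingSet {X : Type*} [TopologicalSpace X] (f : X ≃ₜ X) :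
    IsClosed (nonwanderingSet f) := by
  refine isClosed_iff_clusterPt.2 fun x hx U hU => ?_
  obtain ⟨V, hVU, hV, hxV⟩ := mem_nhds_iff.1 hU
  obtain ⟨y, hyV, hy⟩ := clusterPt_principal_iff.1 hx V (hV.mem_nhds hxV)
  obtain ⟨n, hn, z, ⟨w, hw, hwz⟩, hz⟩ := hy V (hV.mem_nhds hyV)
  exact ⟨n, hn, z, ⟨w, hVU hw, hwz⟩, hVU hz⟩

lemma symm_mem_nonwanderingSet {X : Type*} [TopologicalSpace X] {f : X ≃ₜ X} {x : X}
    (hx : x ∈ nonwanderingSet f) : f.symm x ∈ nonwanderingSet f := by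
  intro U hU
  have hU' : f.symm ⁻¹' U ∈ 𝓝 x := f.symm.continuous.continuousAt hU
  obtain ⟨n, hn, _, ⟨y, hy, rfl⟩, hz⟩ := hx _ hU'
  refine ⟨n, hn, _, ⟨f.symm y, hy, rfl⟩, ?_⟩
  have h : f ((f ^ n) (f.symm y)) = (f ^ n) y := by
    rw [← Homeomorph.mul_apply, ← pow_succ', pow_succ, Homeomorph.mul_apply,
      Homeomorph.apply_symm_apply]
  rwa [mem_preimage, ← h, Homeomorph.symm_apply_apply] at hz

namespace PseudoDA

variable (P : Data)

/-! ### Recurrence of the points outside the basin -/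

lemma anosov_iterate_proj (n : ℕ) (x : ℝ × ℝ) : anosov^[n] (proj x) = proj (linA^[n] x) := by
  have h : ∀ y, anosov (proj y) = proj (linA y) := fun y => by
    ext <;> simp [proj, linA_apply, anosov, two_mul]
  induction n generalizing x with
  | zero => rfl
  | succ n ih => rw [Function.iterate_succ_apply, Function.iterate_succ_apply, h, ih]

/-- Poincaré recurrence of the linear Anosov map, in the plane. -/
lemma exists_linA_recurrence {W : Set (ℝ × ℝ)} (hW : IsOpen W) (hne : W.Nonempty) :
    ∃ w ∈ W, ∃ n : ℕ, n ≠ 0 ∧ ∃ m : ℤ × ℤ, linA^[n] w + ivec m ∈ W := by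
  let _ : MeasurableSpace T2 := borel T2
  have : BorelSpace T2 := ⟨rfl⟩
  let φ : T2 →+ T2 :=
    { toFun := anosov
      map_zero' := by ext <;> simp [anosov]
      map_add' := fun p q => by ext <;> simp only [anosov, Homeomorph.homeomorph_mk_coe,
        Equiv.coe_fn_mk, Prod.fst_add, Prod.snd_add] <;> abel }
  have hφ : MeasureTheory.MeasurePreserving φ
      (MeasureTheory.Measure.addHaar : MeasureTheory.Measure T2) MeasureTheory.Measure.addHaar :=
    AddMonoidHom.measurePreserving (f := φ) anosov.continuous anosov.surjective rfl
  have hopen : IsOpen (proj '' W) := isOpenQuotientMap_proj.isOpenMap _ hW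
  obtain ⟨_, ⟨w, hw, rfl⟩, n, hn, w', hw', h⟩ := hφ.exists_mem_iterate_mem
    hopen.measurableSet.nullMeasurableSet (hopen.measure_pos _ (hne.image _)).ne'
  have h' : proj w' = proj (linA^[n] w) := by rw [h, ← anosov_iterate_proj]; rfl
  obtain ⟨m, rfl⟩ := exists_ivec_of_proj_eq h'
  exact ⟨w, hw, n, hn, m, hw'⟩

lemma coordU_lift_iterate (n : ℕ) (x : ℝ × ℝ) : coordU ((lift P)^[n] x) = lam ^ n * coordU x := by
  induction n with
  | zero => simp
  | succ n ih => rw [Function.iterate_succ_apply', coordU_lift, ih]; ring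

lemma height_lift_iterate (n : ℕ) (x : ℝ × ℝ) :
    height P ((lift P)^[n] x) = mu ^ n * height P x := by
  induction n with
  | zero => simp
  | succ n ih => rw [Function.iterate_succ_apply', height_lift, ih]; ring

lemma coordU_linA_iterate (n : ℕ) (x : ℝ × ℝ) : coordU (linA^[n] x) = lam ^ n * coordU x := by
  induction n with
  | zero => simp
  | succ n ih => rw [Function.iterate_succ_apply', coordU_linA, ih]; ring

lemma coordS_linA_iterate (n : ℕ) (x : ℝ × ℝ) : coordS (linA^[n] x) = mu ^ n * coordS x := by
  induction n with
  | zero => simp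
  | succ n ih => rw [Function.iterate_succ_apply', coordS_linA, ih]; ring

/-- A point that is the only point in its fibre of the semiconjugacy is non-wandering: small
neighbourhoods of its image pull back to small neighbourhoods, and the linear map is recurrent. -/
lemma mem_nonwanderingSet_of_height_lt {y : ℝ × ℝ}
    (hy : ∀ η : ℝ, 0 < η →
      height P (y - η • vs) < height P y ∧ height P y < height P (y + η • vs)) :
    cov y ∈ nonwanderingSet (fPDA P) := by
  intro U hU
  obtain ⟨η, hη, hbox⟩ : ∃ η > 0, ∀ z, |coordU z - coordU y| < η → |coordS z - coordS y| < η →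
      cov z ∈ U := by
    have hc : Continuous fun q : ℝ × ℝ => cov (pt q.1 q.2) := continuous_cov.comp continuous_pt
    have hU' : (fun q : ℝ × ℝ => cov (pt q.1 q.2)) ⁻¹' U ∈ 𝓝 (coordU y, coordS y) :=
      hc.continuousAt (by simpa only [pt_coord] using hU)
    obtain ⟨η, hη, hb⟩ := Metric.mem_nhds_iff.1 hU'
    refine ⟨η, hη, fun z hz1 hz2 => ?_⟩
    have : (coordU z, coordS z) ∈ Metric.ball (coordU y, coordS y) η := by
      rw [Metric.mem_ball, Prod.dist_eq]
      exact max_lt hz1 hz2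
    simpa only [mem_preimage, pt_coord] using hb this
  set ρ := η / 2 with hρ
  have hρ0 : 0 < ρ := half_pos hη
  obtain ⟨h1, h2⟩ := hy ρ hρ0
  -- the points of the plane over which the fibres lie in the box
  set W : Set (ℝ × ℝ) := {w | |coordU w - coordU y| < η ∧
    height P (pt (coordU w) (coordS y - ρ)) < coordS w ∧
    coordS w < height P (pt (coordU w) (coordS y + ρ))} with hWdef
  have hpc : ∀ c : ℝ, Continuous fun w : ℝ × ℝ => height P (pt (coordU w) c) := fun c =>
    (continuous_height P).comp (continuous_pt.comp (continuous_coordU.prodMk continuous_const))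
  have hW : IsOpen W :=
    (isOpen_lt ((continuous_coordU.sub continuous_const).abs) continuous_const).inter
      ((isOpen_lt (hpc _) continuous_coordS).inter (isOpen_lt continuous_coordS (hpc _)))
  have hWne : W.Nonempty := by
    refine ⟨pt (coordU y) (height P y), by simpa using hη, ?_, ?_⟩
    · convert h1 using 1
      · congr 1
        exact ext_coord (by simp [coordU_sub, coordU_smul_vs])
          (by simp [coordS_sub, coordS_smul_vs])
      · simp
    · convert h2 using 1
      · simp
      · congr 1
        exact ext_coord (by simp [coordU_add, coordU_smul_vs])
          (by simp [coordS_add, coordS_smul_vs])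
  have hWU : ∀ z, pt (coordU z) (height P z) ∈ W → cov z ∈ U := by
    rintro z ⟨hz1, hz2, hz3⟩
    simp only [coordU_pt, coordS_pt] at hz1 hz2 hz3
    refine hbox z hz1 (abs_lt.2 ⟨?_, ?_⟩)
    · by_contra h
      have := height_le P (x := z) (z := pt (coordU z) (coordS y - ρ)) (by simp)
        (by rw [coordS_pt]; linarith)
      linarith
    · by_contra h
      have := height_le P (x := pt (coordU z) (coordS y + ρ)) (z := z) (by simp)
        (by rw [coordS_pt]; linarith)
      linarith
  obtain ⟨w, hw, n, hn, m, hm⟩ := exists_linA_recurrence hW hWne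
  obtain ⟨z, hz1, hz2⟩ := exists_height_eq P (coordU w) (coordS w)
  refine ⟨n, Nat.one_le_iff_ne_zero.2 hn, _, ⟨cov z, hWU z ?_, rfl⟩, ?_⟩
  · rwa [hz1, hz2, pt_coord]
  · rw [fPDA_pow_cov, ← cov_add_ivec _ m]
    refine hWU _ ?_
    convert hm using 1
    refine ext_coord ?_ ?_
    · rw [coordU_pt, coordU_add, coordU_add, coordU_lift_iterate, coordU_linA_iterate, hz1]
    · rw [coordS_pt, height_add_ivec, coordS_add, height_lift_iterate, coordS_linA_iterate, hz2]

/-- A point whose height is not that of a point of the lattice is alone in its fibre. -/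
lemma height_lt_of_ne {y : ℝ × ℝ} (hy : ∀ m, height P y ≠ coordS (ivec m)) {η : ℝ} (hη : 0 < η) :
    height P (y - η • vs) < height P y ∧ height P y < height P (y + η • vs) := by
  have hb : ∀ z ∈ basin P, height P z ≠ height P y := by
    rintro z ⟨m, hm⟩ h
    exact hy m (by rw [← h, height_sub_ivec_of_basin P hm])
  have hcoord : ∀ c d : ℝ, coordU (y + c • vs) = coordU (y + d • vs) := fun c d => by
    simp [coordU_add, coordU_smul_vs]
  have hle : ∀ c d : ℝ, c ≤ d → height P (y + c • vs) ≤ height P (y + d • vs) := fun c d h =>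
    height_le P (hcoord c d) (by simpa [coordS_add, coordS_smul_vs] using h)
  have key : ∀ c d : ℝ, c ≤ 0 → 0 ≤ d → c < d →
      height P (y + c • vs) < height P (y + d • vs) := by
    intro c d hc hd hcd
    refine (hle c d hcd.le).lt_of_ne fun heq => ?_
    have h0c := hle c 0 hc
    have h0d := hle 0 d hd
    rw [zero_smul, add_zero] at h0c h0d
    have := height_lt P (x := y + c • vs) (sub_pos.2 hcd) (fun t ht hmem => by
      rw [add_assoc, ← add_smul] at hmem
      have h1 := hle c (c + t) (by linarith [ht.1])
      have h2 := hle (c + t) d (by linarith [ht.2])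
      exact hb _ hmem (by linarith))
    rw [add_assoc, ← add_smul, add_sub_cancel] at this
    exact this.ne heq
  have h1 := key (-η) 0 (by linarith) le_rfl (by linarith)
  have h2 := key 0 η le_rfl hη.le hη
  rw [zero_smul, add_zero] at h1 h2
  rw [sub_eq_add_neg, ← neg_smul]
  exact ⟨h1, h2⟩

/-- The stable direction has irrational slope. -/
lemma coordS_ivec_injective : Function.Injective fun m : ℤ × ℤ => coordS (ivec m) := by
  have key : ∀ m : ℤ × ℤ, coordS (ivec m) = 0 → m = 0 := by
    intro m hm
    have h0 : (√(1 + Real.goldenRatio ^ 2))⁻¹ ≠ 0 := fun h => by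
      have := inv_sqrt_sq
      rw [h] at this; norm_num at this
    have h1 : (m.1 : ℝ) = m.2 * Real.goldenRatio := by
      simp only [coordS, ivec, vs, Prod.smul_fst, Prod.smul_snd, smul_eq_mul] at hm
      refine mul_left_cancel₀ h0 ?_
      linear_combination hm
    have h2 : m.2 = 0 := by
      by_contra h
      have := Real.goldenRatio_irrational.intCast_mul h
      exact this ⟨m.1, by push_cast; exact h1⟩
    rw [h2] at h1
    simp only [Int.cast_zero, zero_mul, Int.cast_eq_zero] at h1
    exact Prod.ext h1 h2
  intro m n h
  have : coordS (ivec (m - n)) = 0 := by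
    rw [ivec_sub, coordS_sub]; exact sub_eq_zero.2 h
  exact sub_eq_zero.1 (key _ this)

/-- Between two points of a stable leaf with different heights lies a non-wandering point. -/
lemma exists_nonwandering_between {x : ℝ × ℝ} {c d : ℝ} (hcd : c ≤ d)
    (h : height P (x + c • vs) < height P (x + d • vs)) :
    ∃ t ∈ Icc c d, cov (x + t • vs) ∈ nonwanderingSet (fPDA P) := by
  have hcount : (range fun m : ℤ × ℤ => coordS (ivec m)).Countable := countable_range _
  obtain ⟨v, hv, hvr⟩ : ∃ v ∈ Icc (height P (x + c • vs)) (height P (x + d • vs)),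
      v ∉ range fun m : ℤ × ℤ => coordS (ivec m) := by
    by_contra! hall
    exact (Cardinal.Real.Icc_countable_iff.1 (hcount.mono hall)).not_gt h
  have hcont : ContinuousOn (fun t : ℝ => height P (x + t • vs)) (Icc c d) :=
    ((continuous_height P).comp (by fun_prop : Continuous fun t : ℝ => x + t • vs)).continuousOn
  obtain ⟨t, ht, htv⟩ := intermediate_value_Icc hcd hcont hv
  refine ⟨t, ht, mem_nonwanderingSet_of_height_lt P fun η hη =>
    height_lt_of_ne P (fun m hm => ?_) hη⟩
  exact hvr ⟨m, hm.symm.trans htv⟩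

/-- The intersection of a stable leaf with the basin of one lattice point is convex. -/
lemma mem_basinZero_of_between {x y z : ℝ × ℝ} (hx : x ∈ basinZero P) (hz : z ∈ basinZero P)
    (hxy : coordU x = coordU y) (hyz : coordU y = coordU z) (h1 : coordS x ≤ coordS y)
    (h2 : coordS y ≤ coordS z) : y ∈ basinZero P := by
  have hlim : ∀ w ∈ basinZero P, Tendsto (fun k => coordS (back P k w)) atTop (𝓝 0) :=
    fun w hw => by
      simpa only [coordS_zero, Function.comp_def] using (continuous_coordS.tendsto 0).comp hw
  exact mem_basinZero_of_coordS P (tendsto_of_tendsto_of_tendsto_of_le_of_le (hlim x hx)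
    (hlim z hz) (fun k => coordS_back_le P hxy h1 k) (fun k => coordS_back_le P hyz h2 k))

/-- Every point outside the basin is non-wandering. Near it on at least one side of its stable
leaf the height is not constant, since otherwise it would lie between two points of the basin in
the same fibre. -/
lemma cov_mem_nonwanderingSet {x : ℝ × ℝ} (hx : x ∉ basin P) :
    cov x ∈ nonwanderingSet (fPDA P) := by
  by_contra hnw
  have hline : Continuous fun t : ℝ => cov (x + t • vs) := continuous_cov.comp (by fun_prop)
  have hU : {t : ℝ | cov (x + t • vs) ∉ nonwanderingSet (fPDA P)} ∈ 𝓝 (0 : ℝ) :=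
    ((isClosed_nonwanderingSet _).isOpen_compl.preimage hline).mem_nhds (by simpa using hnw)
  obtain ⟨ε, hε, hball⟩ := Metric.mem_nhds_iff.1 hU
  have hle : ∀ c d : ℝ, c ≤ d → height P (x + c • vs) ≤ height P (x + d • vs) := fun c d h =>
    height_le P (by simp [coordU_add, coordU_smul_vs])
      (by simpa [coordS_add, coordS_smul_vs] using h)
  have hconst : ∀ c d : ℝ, -ε < c → c ≤ d → d < ε →
      height P (x + c • vs) = height P (x + d • vs) := by
    intro c d hc hcd hd
    refine (hle c d hcd).eq_of_not_lt fun hlt => ?_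
    obtain ⟨t, ht, hmem⟩ := exists_nonwandering_between P hcd hlt
    refine hball (show t ∈ Metric.ball 0 ε from ?_) hmem
    rw [Metric.mem_ball, Real.dist_eq, sub_zero, abs_lt]
    exact ⟨by linarith [ht.1], by linarith [ht.2]⟩
  have hmeets : ∀ c d : ℝ, -ε < c → c < d → d < ε → ∃ t ∈ Icc c d, x + t • vs ∈ basin P := by
    intro c d hc hcd hd
    by_contra! hno
    have := height_lt P (x := x + c • vs) (sub_pos.2 hcd) (fun t ht => by
      rw [add_assoc, ← add_smul]
      exact hno _ ⟨by linarith [ht.1], by linarith [ht.2]⟩)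
    rw [add_assoc, ← add_smul, add_sub_cancel] at this
    exact this.ne (hconst c d hc hcd.le hd)
  obtain ⟨a, ha, m, hma⟩ := hmeets (-(ε / 2)) 0 (by linarith) (by linarith) hε
  obtain ⟨b, hb, n, hnb⟩ := hmeets 0 (ε / 2) (by linarith) (by linarith) (by linarith)
  have hmn : m = n := by
    refine coordS_ivec_injective ?_
    have h1 := height_sub_ivec_of_basin P hma
    have h2 := height_sub_ivec_of_basin P hnb
    have h3 := hconst a b (by linarith [ha.1]) (ha.2.trans hb.1) (by linarith [hb.2])
    exact h1.symm.trans (h3.trans h2)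
  subst hmn
  refine hx ⟨m, mem_basinZero_of_between P hma hnb ?_ ?_ ?_ ?_⟩
  · simp [coordU_sub, coordU_add, coordU_smul_vs]
  · simp [coordU_sub, coordU_add, coordU_smul_vs]
  · simpa [coordS_sub, coordS_add, coordS_smul_vs] using ha.2
  · simpa [coordS_sub, coordS_add, coordS_smul_vs] using hb.1

/-! ### Wandering of the points of the basin -/

lemma ivec_eq_zero_of_norm_lt {m : ℤ × ℤ} (h : ‖ivec m‖ < 1) : m = 0 := by
  have key : ∀ k : ℤ, ‖(k : ℝ)‖ < 1 → k = 0 := fun k hk => by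
    rw [Real.norm_eq_abs, ← Int.cast_abs] at hk
    exact Int.abs_lt_one_iff.1 (by exact_mod_cast hk)
  exact Prod.ext (key _ ((norm_fst_le (ivec m)).trans_lt h))
    (key _ ((norm_snd_le (ivec m)).trans_lt h))

/-- Near the source, every other point is wandering: it has a neighbourhood in a fundamental
annulus of the linear source. -/
lemma cov_notMem_nonwanderingSet_of_gauge_lt {x : ℝ × ℝ} (hx : x ≠ 0)
    (hg : gauge x < √(rate P) * (P.r₀ / 4)) : cov x ∉ nonwanderingSet (fPDA P) := by
  intro hnw
  set σ := √(rate P) with hσ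
  have hσ0 : 0 < σ := Real.sqrt_pos.2 (rate_pos P)
  have hσ1 : σ < 1 := (Real.sqrt_lt' one_pos).2 (by simpa using rate_lt_one P)
  have hσ2 : rate P = σ * σ := (Real.mul_self_sqrt (rate_pos P).le).symm
  have hr := gauge_pos hx
  set r := gauge x with hrdef
  have hopen : IsOpen {y | σ * r < gauge y ∧ σ * gauge y < r} :=
    (isOpen_lt continuous_const continuous_gauge).inter
      (isOpen_lt (continuous_const.mul continuous_gauge) continuous_const)
  have hxU : x ∈ {y | σ * r < gauge y ∧ σ * gauge y < r} := by
    constructor <;> nlinarith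
  obtain ⟨n, hn, _, ⟨_, ⟨y, hy, rfl⟩, h⟩, ⟨z, hz, rfl⟩⟩ := hnw _
    ((isOpenMap_cov _ hopen).mem_nhds (mem_image_of_mem _ hxU))
  have hbd : ∀ w, σ * gauge w < r → gauge w < P.r₀ / 4 := fun w hw =>
    lt_of_mul_lt_mul_left (hw.trans hg) hσ0.le
  have hback : cov (back P n z) = cov y := by
    rw [← fPDA_zpow_neg_cov, ← h, zpow_neg, zpow_natCast, ← Homeomorph.mul_apply,
      inv_mul_cancel]
    rfl
  have hle : gauge (back P n z) ≤ rate P * gauge z := by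
    refine (gauge_back_le P (hbd z hz.2) n).trans (mul_le_mul_of_nonneg_right ?_ (gauge_nonneg z))
    exact pow_le_of_le_one (rate_pos P).le (rate_lt_one P).le (Nat.one_le_iff_ne_zero.1 hn)
  have hlt : gauge (back P n z) < σ * r := by
    rw [hσ2, mul_assoc] at hle
    exact hle.trans_lt (mul_lt_mul_of_pos_left hz.2 hσ0)
  have hg1 : gauge (back P n z) < P.r₀ / 4 := (hlt.trans hy.1).trans (hbd y hy.2)
  have hcontra : ∀ (w : ℝ × ℝ) (m : ℤ × ℤ), gauge w = gauge y → back P n z = w + ivec m →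
      False := by
    intro w m hw hm
    have hnorm : ‖ivec m‖ < 1 := by
      have e : ivec m = back P n z - w := by rw [hm, add_sub_cancel_left]
      rw [e]
      have h1 := norm_le_gauge (back P n z)
      have h2 := norm_le_gauge w
      have h3 := norm_sub_le (back P n z) w
      have h4 := P.r₀_le
      have h5 := hbd y hy.2
      linarith
    rw [ivec_eq_zero_of_norm_lt hnorm, ivec_zero, add_zero] at hm
    rw [hm, hw] at hlt
    exact hlt.not_gt hy.1
  obtain ⟨m, hm | hm⟩ := exists_ivec_of_cov_eq hback
  · exact hcontra y m rfl hm
  · exact hcontra (-y) m (gauge_neg y) hm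

lemma cov_eq_of_mem_basin {x : ℝ × ℝ} (hx : x ∈ basin P)
    (hnw : cov x ∈ nonwanderingSet (fPDA P)) : cov x = cov 0 := by
  obtain ⟨m, hm⟩ := hx
  rw [← cov_sub_ivec x m] at hnw ⊢
  set y := x - ivec m
  obtain ⟨k, hk⟩ := exists_gauge_back_lt P hm (ε := √(rate P) * (P.r₀ / 4))
    (mul_pos (Real.sqrt_pos.2 (rate_pos P)) (by linarith [P.r₀_pos]))
  have hinv : ∀ k, cov (back P k y) ∈ nonwanderingSet (fPDA P) := by
    intro k
    induction k with
    | zero => exact hnw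
    | succ k ih => rw [back_succ, ← fPDA_symm_cov]; exact symm_mem_nonwanderingSet ih
  have hzero : ∀ k, back P k 0 = 0 := by
    intro k
    induction k with
    | zero => rfl
    | succ k ih =>
      have := lift_symm_axis P (v := 0) (by simpa using P.r₀_pos)
      rw [back_succ, ih]
      simpa [pt_zero_zero] using this
  have h0 : back P k y = 0 := by
    by_contra h
    exact cov_notMem_nonwanderingSet_of_gauge_lt P h hk (hinv k)
  congr 1
  exact (lift P).symm.injective.iterate k (h0.trans (hzero k).symm)

lemma zero_mem_basin : (0 : ℝ × ℝ) ∈ basin P :=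
  basinZero_subset_basin P (mem_basinZero_of_gauge_lt P (by simpa using P.r₀_pos))

lemma pieceLambda_eq_attractor : pieceLambda P = attractor P := by
  have hq : quo 0 = cov 0 := rfl
  ext y
  obtain ⟨x, rfl⟩ := cov_surjective y
  rw [pieceLambda, hq, Set.mem_sdiff, mem_singleton_iff, cov_mem_attractor]
  constructor
  · rintro ⟨h1, h2⟩ hb
    exact h2 (cov_eq_of_mem_basin P hb h1)
  · intro hx
    refine ⟨cov_mem_nonwanderingSet P hx, fun h => ?_⟩
    rw [← cov_mem_attractor, h, cov_mem_attractor] at hx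
    exact hx (zero_mem_basin P)

/-- The complement of a small closed neighbourhood of the source isolates the attractor, since the
backward orbits in the basin converge to the source. -/
lemma isIsolatedSet_attractor : IsIsolatedSet (fPDA P) (attractor P) := by
  refine ⟨isClosed_attractor P, fPDA_image_attractor P, ?_⟩
  set ρ := P.r₀ / 8 with hρ
  have hρ0 : 0 < ρ := by have := P.r₀_pos; positivity
  have hK : IsCompact ((fun q : ℝ × ℝ => cov (pt q.1 q.2)) '' (Icc (-ρ) ρ ×ˢ Icc (-ρ) ρ)) :=
    (isCompact_Icc.prod isCompact_Icc).image (continuous_cov.comp continuous_pt)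
  refine ⟨_, hK.isClosed.isOpen_compl.mem_nhdsSet.2 ?_, ?_⟩
  · rintro y hy ⟨⟨u, s⟩, ⟨hu, hs⟩, rfl⟩
    refine (cov_mem_attractor P).1 hy (basinZero_subset_basin P (mem_basinZero_of_gauge_lt P ?_))
    have hlt : ρ < P.r₀ / 4 := by linarith [P.r₀_pos]
    rw [gauge, coordU_pt, coordS_pt]
    exact (max_le (abs_le.2 hu) (abs_le.2 hs)).trans_lt hlt
  · intro y hy
    obtain ⟨x, rfl⟩ := cov_surjective y
    rw [cov_mem_attractor]
    rintro ⟨m, hm⟩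
    obtain ⟨k, hk⟩ := exists_gauge_back_lt P hm hρ0
    refine hy (-(k : ℤ)) ?_
    rw [← cov_sub_ivec x m, fPDA_zpow_neg_cov]
    exact ⟨(coordU (back P k (x - ivec m)), coordS (back P k (x - ivec m))),
      ⟨abs_le.1 ((le_max_left _ _).trans hk.le), abs_le.1 ((le_max_right _ _).trans hk.le)⟩,
      by simp only [pt_coord]⟩

/-! ### Distances in the plane and in the torus -/

lemma dist_proj_le_iff {x y : ℝ × ℝ} {ε : ℝ} :
    dist (proj x) (proj y) ≤ ε ↔ ∃ m : ℤ × ℤ, ‖x - y - ivec m‖ ≤ ε := by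
  have key : ∀ a b : ℝ, dist (a : UnitAddCircle) b = |a - b - round (a - b)| := fun a b => by
    rw [dist_eq_norm, ← AddCircle.coe_sub, UnitAddCircle.norm_eq]
  have hd : dist (proj x) (proj y) = ‖x - y - ivec (round (x.1 - y.1), round (x.2 - y.2))‖ := by
    rw [Prod.dist_eq, Prod.norm_def]
    exact congrArg₂ max (key _ _) (key _ _)
  constructor
  · intro h
    exact ⟨_, hd ▸ h⟩
  · rintro ⟨m, hm⟩
    rw [Prod.norm_def, max_le_iff] at hm
    rw [Prod.dist_eq]
    refine max_le ?_ ?_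
    · exact ((key _ _).trans_le (round_le _ m.1)).trans hm.1
    · exact ((key _ _).trans_le (round_le _ m.2)).trans hm.2

/-- A continuous map of the plane that lifts a map of the torus is uniformly continuous. -/
lemma exists_norm_sub_lt {g : ℝ × ℝ → ℝ × ℝ} (hg : Continuous g)
    (hper : ∀ (m : ℤ × ℤ) x y, g (x + ivec m) - g (y + ivec m) = g x - g y) :
    ∃ δ > 0, ∀ x y, ‖x - y‖ < δ → ‖g x - g y‖ < 1 / 2 := by
  have huc : UniformContinuousOn g (Icc (-1, -1) (2, 2)) :=
    isCompact_Icc.uniformContinuousOn_of_continuous hg.continuousOn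
  obtain ⟨δ, hδ, h⟩ := Metric.uniformContinuousOn_iff.1 huc (1 / 2) (by norm_num)
  refine ⟨min δ 1, lt_min hδ one_pos, fun x y hxy => ?_⟩
  obtain ⟨hxy1, hxy2⟩ := lt_min_iff.1 hxy
  obtain ⟨m, ⟨h1, h2⟩, ⟨h3, h4⟩⟩ := exists_ivec_mem_unitSquare x
  have h5 := abs_lt.1 ((norm_fst_le (x - y)).trans_lt hxy2)
  have h6 := abs_lt.1 ((norm_snd_le (x - y)).trans_lt hxy2)
  simp only [Prod.fst_add, Prod.snd_add, Prod.fst_zero, Prod.snd_zero, Prod.fst_one, Prod.snd_one,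
    Prod.fst_sub, Prod.snd_sub] at h1 h2 h3 h4 h5 h6
  have := h (x + ivec m) ⟨⟨?_, ?_⟩, ⟨?_, ?_⟩⟩ (y + ivec m) ⟨⟨?_, ?_⟩, ⟨?_, ?_⟩⟩
    (by rwa [dist_add_right, dist_eq_norm])
  · rwa [dist_eq_norm, hper] at this
  all_goals simp only [Prod.fst_add, Prod.snd_add]; linarith

/-- Lifts of orbits of the torus that start close to each other stay as close as the orbits. -/
lemma norm_iterate_sub_le {g : ℝ × ℝ → ℝ × ℝ} {ε : ℝ} (hε : ε < 1 / 2)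
    (hg : ∀ x y, ‖x - y‖ ≤ ε → ‖g x - g y‖ < 1 / 2) {x y : ℝ × ℝ} (h0 : ‖x - y‖ ≤ ε)
    (hd : ∀ n, dist (proj (g^[n] x)) (proj (g^[n] y)) ≤ ε) (n : ℕ) :
    ‖g^[n] x - g^[n] y‖ ≤ ε := by
  induction n with
  | zero => exact h0
  | succ n ih =>
    obtain ⟨m, hm⟩ := dist_proj_le_iff.1 (hd (n + 1))
    have h1 := hg _ _ ih
    rw [← Function.iterate_succ_apply' g, ← Function.iterate_succ_apply' g] at h1
    have h2 : ‖ivec m‖ < 1 := by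
      have e : ivec m = (g^[n + 1] x - g^[n + 1] y) - (g^[n + 1] x - g^[n + 1] y - ivec m) := by
        abel
      rw [e]
      exact (norm_sub_le _ _).trans_lt (by linarith)
    rwa [ivec_eq_zero_of_norm_lt h2, ivec_zero, sub_zero] at hm

/-! ### Continua of the sphere and of the torus -/

/-- The preimage in the torus of a nondegenerate continuum of the sphere contains a nondegenerate
connected set. If it were totally disconnected, a symmetric clopen part of it would disconnect
the continuum. -/
lemma exists_connected_lift {C : Set S2} (hC : IsClosed C) (hconn : IsPreconnected C)
    (hnt : C.Nontrivial) : ∃ K ⊆ quo ⁻¹' C, IsPreconnected K ∧ K.Nontrivial := by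
  set E : Set T2 := quo ⁻¹' C with hE
  have hEc : IsClosed E := hC.preimage isQuotientMap_quo.continuous
  have hneg : ∀ p, p ∈ E → -p ∈ E := fun p hp => by
    rw [hE, mem_preimage, quo_neg]; exact hp
  suffices hdis : ¬ IsTotallyDisconnected E by
    unfold IsTotallyDisconnected at hdis
    push Not at hdis
    obtain ⟨K, hK, hpre, hns⟩ := hdis
    exact ⟨K, hK, hpre, hns⟩
  intro hdis
  have : TotallyDisconnectedSpace E := totallyDisconnectedSpace_subtype_iff.2 hdis
  have : CompactSpace E := isCompact_iff_compactSpace.1 hEc.isCompact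
  obtain ⟨y, ha, z, hb, hab⟩ := hnt
  obtain ⟨p, rfl⟩ := quo_surjective y
  obtain ⟨q, rfl⟩ := quo_surjective z
  let σ : E → E := fun e => ⟨-e.1, hneg _ e.2⟩
  have hσ : Continuous σ := by
    refine Continuous.subtype_mk ?_ _
    exact continuous_neg.comp continuous_subtype_val
  have hσσ : ∀ e, σ (σ e) = e := fun e => Subtype.ext (neg_neg _)
  let a : E := ⟨p, ha⟩
  let b : E := ⟨q, hb⟩
  have hne1 : a ≠ b := fun h => hab (congrArg (fun e : E => quo e.1) h)
  have hne2 : a ≠ σ b := fun h => hab ((congrArg (fun e : E => quo e.1) h).trans (quo_neg q))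
  obtain ⟨Z₁, hZ₁, ha₁, hb₁⟩ := exists_isClopen_of_totally_separated hne1
  obtain ⟨Z₂, hZ₂, ha₂, hb₂⟩ := exists_isClopen_of_totally_separated hne2
  set Z : Set E := (Z₁ ∩ Z₂) ∪ σ ⁻¹' (Z₁ ∩ Z₂) with hZdef
  have hZ : IsClopen Z := (hZ₁.inter hZ₂).union ((hZ₁.inter hZ₂).preimage hσ)
  have haZ : a ∈ Z := Or.inl ⟨ha₁, ha₂⟩
  have hbZ : b ∉ Z := by
    rintro (h | h)
    · exact hb₁ h.1
    · exact hb₂ h.2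
  have hsymm : ∀ e, σ e ∈ Z ↔ e ∈ Z := fun e => by
    simp only [hZdef, mem_union, mem_preimage, hσσ, or_comm]
  have hq : Continuous fun e : E => quo e.1 :=
    isQuotientMap_quo.continuous.comp continuous_subtype_val
  have hclosed : ∀ W : Set E, IsClosed W → IsClosed ((fun e : E => quo e.1) '' W) := fun W hW =>
    hq.isClosedMap W hW
  obtain ⟨_, -, ⟨⟨e, he, rfl⟩, ⟨e', he', h⟩⟩⟩ := isPreconnected_closed_iff.1 hconn _ _
    (hclosed Z hZ.1) (hclosed Zᶜ hZ.compl.1) (fun y hy => by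
      obtain ⟨r, rfl⟩ := quo_surjective y
      by_cases hr : (⟨r, hy⟩ : E) ∈ Z
      · exact Or.inl ⟨_, hr, rfl⟩
      · exact Or.inr ⟨_, hr, rfl⟩)
    ⟨quo p, ha, a, haZ, rfl⟩ ⟨quo q, hb, b, hbZ, rfl⟩
  rcases quo_eq_iff.1 h with h | h
  · exact he' ((Subtype.ext h : e' = e) ▸ he)
  · exact he' ((Subtype.ext h : e' = σ e) ▸ (hsymm e).2 he)

/-- A connected set of the torus with small image in the sphere is small. -/
lemma dist_le_of_dist_quo_le {S : Set T2} (hS : IsPreconnected S) {ε : ℝ}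
    (h : ∀ a ∈ S, ∀ b ∈ S, dist (quo a) (quo b) ≤ ε) {a b : T2} (ha : a ∈ S) (hb : b ∈ S) :
    dist a b ≤ 3 * ε := by
  have hε : 0 ≤ ε := dist_nonneg.trans (h a ha a ha)
  by_contra hlt
  have hab := h a ha b hb
  rw [dist_quo, min_le_iff] at hab
  rcases hab with hab | hab
  · linarith
  have hneg : ∀ c, dist (-a) c = dist a (-c) := fun c => by rw [← dist_neg_neg, neg_neg]
  obtain ⟨c, -, hc1, hc2⟩ := isPreconnected_closed_iff.1 hS (Metric.closedBall a ε)
    (Metric.closedBall (-a) ε) Metric.isClosed_closedBall Metric.isClosed_closedBall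
    (fun c hc => by
      have := h a ha c hc
      rw [dist_quo, min_le_iff] at this
      rcases this with h1 | h1
      · exact Or.inl (by rwa [Metric.mem_closedBall, dist_comm])
      · exact Or.inr (by rwa [Metric.mem_closedBall, dist_comm, hneg]))
    ⟨a, ha, Metric.mem_closedBall_self hε⟩
    ⟨b, hb, by rwa [Metric.mem_closedBall, dist_comm, hneg]⟩
  rw [Metric.mem_closedBall, dist_comm] at hc1
  rw [Metric.mem_closedBall] at hc2
  have h1 := dist_triangle4 a c (-a) b
  rw [hneg] at h1
  linarith

/-! ### Continuum-wise expansivity -/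

/-- Points of the plane whose full orbits stay close to each other lie on the same stable leaf. -/
lemma coordU_eq_of_norm_iterate_le {x y : ℝ × ℝ} {ε : ℝ}
    (h : ∀ n, ‖(lift P)^[n] x - (lift P)^[n] y‖ ≤ ε) : coordU x = coordU y := by
  by_contra hne
  have hpos : 0 < |coordU x - coordU y| := abs_pos.2 (sub_ne_zero.2 hne)
  obtain ⟨n, hn⟩ := pow_unbounded_of_one_lt (2 * ε / |coordU x - coordU y|) one_lt_lam
  rw [div_lt_iff₀ hpos] at hn
  have h1 := (abs_coordU_le ((lift P)^[n] x - (lift P)^[n] y)).trans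
    (mul_le_mul_of_nonneg_left (h n) zero_le_two)
  rw [coordU_sub, coordU_lift_iterate, coordU_lift_iterate, ← mul_sub, abs_mul,
    abs_of_pos (pow_pos lam_pos n)] at h1
  linarith

/-- A connected set of the torus that lies in the image of a short stable segment contains, with
two points, the image of the segment between them, because short stable segments are embedded. -/
lemma segment_subset_of_proj_subset {K : Set T2} (hK : IsPreconnected K) {x : ℝ × ℝ} {r : ℝ}
    (hr : 2 * r < 1) (hsub : ∀ p ∈ K, ∃ t ∈ Icc (-r) r, proj (x + t • vs) = p) {c d : ℝ}
    (hc : c ∈ Icc (-r) r) (hd : d ∈ Icc (-r) r) (hcK : proj (x + c • vs) ∈ K)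
    (hdK : proj (x + d • vs) ∈ K) : ∀ t ∈ Icc c d, proj (x + t • vs) ∈ K := by
  let f : Icc (-r) r → T2 := fun t => proj (x + t.1 • vs)
  have hf : Continuous f := by
    have : Continuous fun t : Icc (-r) r => x + t.1 • vs := by fun_prop
    exact isOpenQuotientMap_proj.continuous.comp this
  have hinj : Function.Injective f := by
    intro s t hst
    obtain ⟨m, hm⟩ := exists_ivec_of_proj_eq hst
    have e : ivec m = (s.1 - t.1) • vs := by
      rw [sub_smul, ← add_sub_add_left_eq_sub _ _ x, hm, add_sub_cancel_left]
    have hm0 : m = 0 := by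
      refine ivec_eq_zero_of_norm_lt ?_
      rw [e, norm_smul]
      refine (mul_le_of_le_one_right (norm_nonneg _) norm_vs_le).trans_lt ?_
      rw [Real.norm_eq_abs, abs_lt]
      constructor <;> linarith [s.2.1, s.2.2, t.2.1, t.2.2]
    have h1 := coordS_smul_vs (s.1 - t.1)
    rw [← e, hm0, ivec_zero, coordS_zero] at h1
    exact Subtype.ext (by linarith)
  have hpre := hK.preimage_of_isClosedMap hinj hf.isClosedMap (fun p hp => by
    obtain ⟨t, ht, h⟩ := hsub p hp
    exact ⟨⟨t, ht⟩, h⟩)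
  have hord := (hpre.image _ continuous_subtype_val.continuousOn).ordConnected
  intro t ht
  obtain ⟨s, hs, rfl⟩ := hord.out ⟨⟨c, hc⟩, hcK, rfl⟩ ⟨⟨d, hd⟩, hdK, rfl⟩ ht
  exact hs

lemma dist_le_diam_sphere {A : Set S2} {a b : S2} (ha : a ∈ A) (hb : b ∈ A) :
    dist a b ≤ Metric.diam A := by
  have : CompactSpace S2 := quo_surjective.compactSpace isQuotientMap_quo.continuous
  exact Metric.dist_le_diam_of_mem Metric.isBounded_of_compactSpace ha hb

lemma fDA_zpow_proj (n : ℤ) (x : ℝ × ℝ) : (fDA P ^ n) (proj x) = proj ((lift P ^ n) x) :=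
  zpow_semiconj (f := lift P) (g := fDA P) (q := proj) (fun y => (proj_lift P y).symm) n x

lemma fPDA_zpow_quo (n : ℤ) (p : T2) : (fPDA P ^ n) (quo p) = quo ((fDA P ^ n) p) :=
  zpow_semiconj (f := fDA P) (g := fPDA P) (q := quo) (fPDA_quo P) n p

lemma cwExpansiveOn_attractor : CwExpansiveOn (fPDA P) (attractor P) := by
  obtain ⟨δ₁, hδ₁, h₁⟩ := exists_norm_sub_lt (g := lift P) (lift P).continuous
    (fun m x y => by rw [lift_add_ivec, lift_add_ivec, add_sub_add_right_eq_sub])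
  obtain ⟨δ₂, hδ₂, h₂⟩ := exists_norm_sub_lt (g := (lift P).symm) (lift P).symm.continuous
    (fun m x y => by rw [lift_symm_add_ivec, lift_symm_add_ivec, add_sub_add_right_eq_sub])
  obtain ⟨ε, hε, hε1, hε2, hε3⟩ : ∃ ε > 0, 3 * ε < δ₁ ∧ 3 * ε < δ₂ ∧ 12 * ε < 1 := by
    refine ⟨min (min δ₁ δ₂) 1 / 13, by positivity, ?_, ?_, ?_⟩
    · have := (min_le_left (min δ₁ δ₂) 1).trans (min_le_left _ _); linarith
    · have := (min_le_left (min δ₁ δ₂) 1).trans (min_le_right _ _); linarith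
    · have := min_le_right (min δ₁ δ₂) 1; linarith
  refine ⟨ε, hε, fun C hCsub hCcl hCconn hCnt => ?_⟩
  by_contra! hdiam
  obtain ⟨K, hKC, hKconn, hKnt⟩ := exists_connected_lift hCcl hCconn.isPreconnected hCnt
  have hdist : ∀ n : ℤ, ∀ p ∈ K, ∀ q ∈ K, dist ((fDA P ^ n) p) ((fDA P ^ n) q) ≤ 3 * ε := by
    intro n p hp q hq
    refine dist_le_of_dist_quo_le (hKconn.image _ (fDA P ^ n).continuous.continuousOn) ?_
      (mem_image_of_mem _ hp) (mem_image_of_mem _ hq)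
    rintro _ ⟨a, ha, rfl⟩ _ ⟨b, hb, rfl⟩
    rw [← fPDA_zpow_quo, ← fPDA_zpow_quo]
    refine le_trans ?_ (hdiam n)
    exact dist_le_diam_sphere (mem_image_of_mem _ (hKC ha)) (mem_image_of_mem _ (hKC hb))
  obtain ⟨p₀, hp₀, p₁, hp₁, hne⟩ := hKnt
  obtain ⟨x₀, rfl⟩ := proj_surjective p₀
  -- the points of `K` lift to a stable segment, on which backward iterates stay bounded
  have hlift : ∀ p ∈ K, ∃ t ∈ Icc (-(6 * ε)) (6 * ε), proj (x₀ + t • vs) = p ∧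
      ∀ k, ‖back P k (x₀ + t • vs) - back P k x₀‖ ≤ 3 * ε := by
    intro p hp
    obtain ⟨y, rfl⟩ := proj_surjective p
    obtain ⟨m, hm⟩ := dist_proj_le_iff.1 (hdist 0 _ hp _ hp₀)
    obtain ⟨x, hx, hxy⟩ : ∃ x, proj x = proj y ∧ ‖x - x₀‖ ≤ 3 * ε :=
      ⟨y + ivec (-m), proj_add_ivec _ _, by
        rwa [ivec_neg, ← sub_eq_add_neg, sub_right_comm]⟩
    rw [← hx] at hp ⊢
    have hfwd := norm_iterate_sub_le (g := lift P) (ε := 3 * ε) (by linarith)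
      (fun a b hab => h₁ a b (hab.trans_lt hε1)) hxy (fun n => by
        rw [← lift_zpow_natCast, ← lift_zpow_natCast, ← fDA_zpow_proj, ← fDA_zpow_proj]
        exact hdist n _ hp _ hp₀)
    have hbwd := norm_iterate_sub_le (g := (lift P).symm) (ε := 3 * ε) (by linarith)
      (fun a b hab => h₂ a b (hab.trans_lt hε2)) hxy (fun n => by
        change dist (proj (back P n x)) (proj (back P n x₀)) ≤ _
        rw [← lift_zpow_neg_natCast, ← lift_zpow_neg_natCast, ← fDA_zpow_proj, ← fDA_zpow_proj]
        exact hdist _ _ hp _ hp₀)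
    have hxe := add_smul_vs_eq (coordU_eq_of_norm_iterate_le P hfwd).symm
    refine ⟨coordS x - coordS x₀, ?_, by rw [← hxe], fun k => by rw [← hxe]; exact hbwd k⟩
    rw [← coordS_sub]
    exact abs_le.1 ((abs_coordS_le _).trans (by linarith))
  have hbasin : ∀ t : ℝ, proj (x₀ + t • vs) ∈ K → x₀ + t • vs ∉ basin P := fun t ht =>
    (cov_mem_attractor P).1 (hCsub (hKC ht))
  obtain ⟨t, ht, htp, htk⟩ := hlift p₁ hp₁
  have ht0 : t ≠ 0 := by
    rintro rfl
    rw [zero_smul, add_zero] at htp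
    exact hne htp
  have hcoord : ∀ k, |coordS (back P k (x₀ + t • vs)) - coordS (back P k x₀)| ≤ 6 * ε := fun k => by
    rw [← coordS_sub]
    exact (abs_coordS_le _).trans (by linarith [htk k])
  have hseg : ∀ c d, c ∈ Icc (-(6 * ε)) (6 * ε) → d ∈ Icc (-(6 * ε)) (6 * ε) →
      proj (x₀ + c • vs) ∈ K → proj (x₀ + d • vs) ∈ K → ∀ r ∈ Icc 0 (d - c),
      x₀ + c • vs + r • vs ∉ basin P := by
    intro c d hc hd hcK hdK r hr
    rw [add_assoc, ← add_smul]
    refine hbasin _ (segment_subset_of_proj_subset hKconn (by linarith)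
      (fun p hp => ?_) hc hd hcK hdK _ ⟨by linarith [hr.1], by linarith [hr.2]⟩)
    obtain ⟨s, hs, hsp, -⟩ := hlift p hp
    exact ⟨s, hs, hsp⟩
  have h0mem : (0 : ℝ) ∈ Icc (-(6 * ε)) (6 * ε) := ⟨by linarith, by linarith⟩
  have h0K : proj (x₀ + (0 : ℝ) • vs) ∈ K := by rwa [zero_smul, add_zero]
  have htK : proj (x₀ + t • vs) ∈ K := by rwa [htp]
  rcases lt_or_gt_of_ne ht0 with hneg | hpos
  · obtain ⟨k, hk⟩ := unbounded_back_segment P (b := 0 - t) (by linarith)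
      (hseg t 0 ht h0mem htK h0K) (6 * ε)
    rw [add_assoc, ← add_smul, add_sub_cancel, zero_smul, add_zero] at hk
    linarith [(abs_le.1 (hcoord k)).1]
  · obtain ⟨k, hk⟩ := unbounded_back_segment P (b := t - 0) (by linarith)
      (hseg 0 t h0mem ht h0K htK) (6 * ε)
    rw [add_assoc, ← add_smul, zero_add, sub_zero, zero_smul, add_zero] at hk
    linarith [(abs_le.1 (hcoord k)).2]

end PseudoDA
end

theorem mainTheorem6 (P : PseudoDA.Data) :
    CwExpansiveOn (PseudoDA.fPDA P) (PseudoDA.pieceLambda P) ∧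
      IsIsolatedSet (PseudoDA.fPDA P) (PseudoDA.pieceLambda P) := by
  rw [PseudoDA.pieceLambda_eq_attractor]
  exact ⟨PseudoDA.cwExpansiveOn_attractor P, PseudoDA.isIsolatedSet_attractor P⟩
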